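/- Let $d\ge 3$ and $N\ge 0$ be integers. Let $f:[0,\infty)\to[0,\infty)$ be a non-negative function of the form $$f(s)=\sum_{j=0}^\infty \alpha_j s^j+\int_{\mathbb R}e^{-\alpha s}\,dm(\alpha),\qquad s\ge 0,$$ where $\alpha_0,\alpha_1\in\mathbb R$, $\alpha_j\ge 0$ for $j\ge 2$, $m$ is a non-negative Borel measure on $\mathbb R$, and the series and the integral converge for every $s\ge 0$. Put $$F(\lambda)=\int_0^\infty f(s)\,e^{-s/\lambda}\,\frac{ds}{s}\in[0,\infty],\qquad \lambda>0,$$ and $F(0)=0$. Let $V$ be a measurable function on $\mathbb R^d$ with values in the non-negative Hermitian $N\times N$ matrices, which is integrable and essentially bounded. Then $V^{1/2}(-\Delta)^{-1}V^{1/2}$, understood as $A^*A$ with $A=(-\Delta)^{-1/2}V^{1/2}$, is a well-defined bounded operator on $L^2(\mathbb R^d;\mathbb C^N)$, it is compact, and $$\operatorname{tr}_{L^2(\mathbb R^d;\mathbb C^N)}F\big(V^{1/2}(-\Delta)^{-1}V^{1/2}\big)\le\frac{1}{(4\pi)^{d/2}}\left(\int_0^\infty\frac{f(s)}{s^{d/2}}\,\frac{ds}{s}\right)\int_{\mathbb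 R^d}\operatorname{tr}_{\mathbb C^N}\big[V(x)^{d/2}\big]\,dx .$$ Here the left side is the sum of $F(\lambda)$ over the positive eigenvalues $\lambda$ of the operator, counted with multiplicity, and both sides take values in $[0,\infty]$ with the convention $0\cdot\infty=0$. -/

import Mathlib

noncomputable section

namespace MatrixCLR

open MeasureTheory Set
open scoped ENNReal FourierTransform

/-- The configuration space `ℝ^d` with its Euclidean norm. -/
abbrev Space (d : ℕ) : Type := EuclideanSpace ℝ (Fin d)

/-- The Hilbert space `L²(ℝ^d; ℂ^N)`. -/
abbrev L2 (d N : ℕ) : Type :=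
  Lp (EuclideanSpace ℂ (Fin N)) 2 (volume : Measure (Space d))

/-- `f` has the form `f(s) = ∑_j a_j s^j + ∫_ℝ e^{-α s} dm(α)` for all `s ≥ 0`, where
`a_0, a_1 ∈ ℝ`, `a_j ≥ 0` for `j ≥ 2`, `m` is a non-negative Borel measure on `ℝ`, and the series
and the integral converge for all `s ≥ 0`. -/
def IsJensenForm (f : ℝ → ℝ) : Prop :=
  ∃ (a : ℕ → ℝ) (m : Measure ℝ),
    (∀ j, 2 ≤ j → 0 ≤ a j) ∧
    ∀ s : ℝ, 0 ≤ s →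
      Summable (fun j => a j * s ^ j) ∧
      Integrable (fun α : ℝ => Real.exp (-(α * s))) m ∧
      f s = ∑' j, a j * s ^ j + ∫ α, Real.exp (-(α * s)) ∂m

/-- `F(lam) = ∫_0^∞ f(s) e^{-s/lam} s^{-1} ds ∈ [0, ∞]`, for `f ≥ 0` and `lam > 0`. -/
def transformF (f : ℝ → ℝ) (lam : ℝ) : ℝ≥0∞ :=
  ∫⁻ s in Ioi (0 : ℝ), ENNReal.ofReal (f s * Real.exp (-(s / lam)) * s⁻¹)

/-- `M` is the operator of multiplication by the matrix-valued function `W`. -/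
def IsMultiplication {d N : ℕ} (W : Space d → Matrix (Fin N) (Fin N) ℂ)
    (M : L2 d N →L[ℂ] L2 d N) : Prop :=
  ∀ u : L2 d N, ∀ᵐ x ∂(volume : Measure (Space d)),
    M u x = Matrix.toEuclideanCLM (𝕜 := ℂ) (W x) (u x)

/-- `h` lies in the domain of `(-Δ)^{1/2}` and `(-Δ)^{1/2} h = g`, equivalently
`h = (-Δ)^{-1/2} g`. With the Fourier transform `𝓕 u(ξ) = ∫ e^{-2πi x·ξ} u(x) dx`
(extended to `L²`), the operator `-Δ` is multiplication by `(2π|ξ|)²` in Fourier space. -/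
def IsInvSqrtLaplacian {d N : ℕ} (g h : L2 d N) : Prop :=
  ∀ᵐ ξ ∂(volume : Measure (Space d)),
    (𝓕 g : L2 d N) ξ = ((2 * Real.pi * ‖ξ‖ : ℝ) : ℂ) • (𝓕 h : L2 d N) ξ

/-- `K = V^{1/2} (-Δ)^{-1} V^{1/2}`, that is `K = A* A` with `A = (-Δ)^{-1/2} V^{1/2}`
an everywhere defined bounded operator on `L²(ℝ^d; ℂ^N)`. -/
def IsBirmanSchwinger {d N : ℕ} (V : Space d → Matrix (Fin N) (Fin N) ℂ)
    (K : L2 d N →L[ℂ] L2 d N) : Prop :=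
  ∃ M A : L2 d N →L[ℂ] L2 d N,
    IsMultiplication (fun x => cfc Real.sqrt (V x)) M ∧
    (∀ u, IsInvSqrtLaplacian (M u) (A u)) ∧
    K = (ContinuousLinearMap.adjoint A).comp A

/-- `tr F(K) ∈ [0, ∞]` for a compact operator `K ≥ 0` on a Hilbert space and `F : (0, ∞) → [0, ∞]`
(with the convention `F(0) = 0`): the sum of `F(lam)` over the eigenvalues `lam > 0` of `K`,
each counted with its multiplicity. -/
def traceOfFun {H : Type*} [NormedAddCommGroup H] [InnerProductSpace ℂ H]
    (F : ℝ → ℝ≥0∞) (K : H →L[ℂ] H) : ℝ≥0∞ :=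
  ∑' lam : Ioi (0 : ℝ),
    ((Cardinal.toENat (Module.rank ℂ
      (Module.End.eigenspace (K : H →ₗ[ℂ] H) ((lam : ℝ) : ℂ))) : ℕ∞) : ℝ≥0∞) * F lam

/-- `tr_{ℂ^N} [B^p]` for a Hermitian matrix `B ≥ 0`. -/
def trPow {N : ℕ} (B : Matrix (Fin N) (Fin N) ℂ) (p : ℝ) : ℝ :=
  (cfc (fun t : ℝ => t ^ p) B).trace.re

end MatrixCLR

end

open MeasureTheory Set MatrixCLR
open scoped ComplexOrder

section HilbertSpace

variable {H : Type} [NormedAddCommGroup H] [InnerProductSpace ℂ H] [CompleteSpace H]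

/-- A bounded operator whose Hilbert–Schmidt norm is finite is compact. -/
theorem isCompactOperator_of_sum_norm_sq_le {H' : Type*} [NormedAddCommGroup H']
    [InnerProductSpace ℂ H'] [CompleteSpace H'] (B : H →L[ℂ] H') (C : ℝ)
    (hB : ∀ (ι : Type) [Fintype ι] (e : ι → H), Orthonormal ℂ e → ∑ i, ‖B (e i)‖ ^ 2 ≤ C) :
    IsCompactOperator B := by
  obtain ⟨w, b, -⟩ := exists_hilbertBasis ℂ H
  have hsum : Summable fun i : w => ‖B (b i)‖ ^ 2 := by
    refine summable_of_sum_le (c := C) (fun i => by positivity) fun s => ?_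
    have := hB s (fun i => b i) (b.orthonormal.comp _ Subtype.val_injective)
    rwa [Finset.sum_coe_sort s (fun i => ‖B (b i)‖ ^ 2)] at this
  let T : Finset w → (H →L[ℂ] H') := fun s => ∑ i ∈ s, (innerSL ℂ (b i)).smulRight (B (b i))
  have hT : ∀ s, IsCompactOperator (T s) := by
    intro s
    have : ∀ i, IsCompactOperator ((innerSL ℂ (b i)).smulRight (B (b i))) := by
      intro i
      have h1 : IsCompactOperator (innerSL ℂ (b i)) :=
        ((isCompactOperator_id_iff_finiteDimensional (𝕜 := ℂ) (E := ℂ)).2 inferInstance).comp_clm _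
      exact h1.clm_comp ((ContinuousLinearMap.id ℂ ℂ).smulRight (B (b i)))
    exact Submodule.sum_mem (compactOperator (RingHom.id ℂ) H H') fun i _ => this i
  refine isCompactOperator_of_tendsto (l := Filter.atTop) (F := T) ?_ (Filter.Eventually.of_forall hT)
  rw [tendsto_iff_norm_sub_tendsto_zero]
  have htail := (tendsto_tsum_compl_atTop_zero fun i : w => ‖B (b i)‖ ^ 2)
  have hsq := (Real.continuous_sqrt.tendsto 0).comp htail
  rw [Real.sqrt_zero] at hsq
  refine squeeze_zero (fun _ => norm_nonneg _) (fun s => ?_) hsq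
  refine ContinuousLinearMap.opNorm_le_bound _ (Real.sqrt_nonneg _) fun u => ?_
  have hu : HasSum (fun i => b.repr u i • B (b i)) (B u) := by
    simpa using (b.hasSum_repr u).mapL B
  have hTs : T s u = ∑ i ∈ s, b.repr u i • B (b i) := by
    simp [T, b.repr_apply_apply]
  have hd : B u - T s u = ∑' i : {i // i ∉ s}, b.repr u i • B (b i) := by
    rw [hTs, ← hu.tsum_eq, ← hu.summable.sum_add_tsum_subtype_compl s]
    simp
  have hnsum : Summable fun i : w => ‖b.repr u i‖ ^ 2 := by
    have := b.summable_inner_mul_inner u u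
    refine (this.norm).congr fun i => ?_
    rw [norm_mul, norm_inner_symm u, b.repr_apply_apply, sq]
  have hnle : ∑' i : {i // i ∉ s}, ‖b.repr u i‖ ^ 2 ≤ ‖u‖ ^ 2 := by
    refine (Summable.tsum_subtype_le (fun i : w => ‖b.repr u i‖ ^ 2) _ (fun _ => by positivity)
      hnsum).trans (le_of_eq ?_)
    rw [← b.repr.norm_map u]
    have := lp.norm_rpow_eq_tsum (p := 2) (by norm_num) (b.repr u)
    simpa using this.symm
  have hs1 : Summable fun i : {i // i ∉ s} => ‖b.repr u i‖ ^ (2 : ℝ) := by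
    simpa [Function.comp_def] using hnsum.comp_injective
      (Subtype.val_injective : Function.Injective (Subtype.val : {i // i ∉ s} → w))
  have hs2 : Summable fun i : {i // i ∉ s} => ‖B (b i)‖ ^ (2 : ℝ) := by
    simpa [Function.comp_def] using hsum.comp_injective
      (Subtype.val_injective : Function.Injective (Subtype.val : {i // i ∉ s} → w))
  have hCS := Real.inner_le_Lp_mul_Lq_tsum_of_nonneg (p := 2) (q := 2)
    Real.HolderConjugate.two_two
    (fun i : {i // i ∉ s} => norm_nonneg (b.repr u i)) (fun i => norm_nonneg (B (b i))) hs1 hs2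
  have hCSs := Real.summable_mul_of_Lp_Lq_of_nonneg (p := 2) (q := 2)
    Real.HolderConjugate.two_two
    (fun i : {i // i ∉ s} => norm_nonneg (b.repr u i)) (fun i => norm_nonneg (B (b i))) hs1 hs2
  rw [← neg_sub B (T s), _root_.neg_apply, norm_neg, _root_.sub_apply, hd]
  calc ‖∑' i : {i // i ∉ s}, b.repr u i • B (b i)‖
      ≤ ∑' i : {i // i ∉ s}, ‖b.repr u i‖ * ‖B (b i)‖ := by
        refine (norm_tsum_le_tsum_norm ?_).trans (le_of_eq ?_)
        · simpa [norm_smul] using hCSs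
        · simp [norm_smul]
    _ ≤ _ := hCS
    _ ≤ _ := by
        rw [mul_comm, ← Real.sqrt_eq_rpow, ← Real.sqrt_eq_rpow]
        simp only [Real.rpow_two]
        refine mul_le_mul le_rfl ?_ (Real.sqrt_nonneg _) (Real.sqrt_nonneg _)
        rw [Real.sqrt_le_left (norm_nonneg _)]
        exact hnle

/-- A compact self-adjoint operator has a Hilbert basis of eigenvectors. -/
theorem exists_hilbertBasis_eigenvectors (K : H →L[ℂ] H) (hc : IsCompactOperator K)
    (hs : K.IsSymmetric) :
    ∃ (ι : Type) (b : HilbertBasis ι ℂ H) (μ : ι → ℝ), ∀ i, K (b i) = ((μ i : ℝ) : ℂ) • b i := by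
  have hclosed : ∀ μ : ℂ, IsClosed (Module.End.eigenspace (K : H →ₗ[ℂ] H) μ : Set H) := by
    intro μ
    have : (Module.End.eigenspace (K : H →ₗ[ℂ] H) μ : Set H) = {x | K x = μ • x} := by
      ext x; simp
    rw [this]
    exact isClosed_eq K.continuous (continuous_const_smul μ)
  have : ∀ μ : ℂ, CompleteSpace (Module.End.eigenspace (K : H →ₗ[ℂ] H) μ) := fun μ =>
    (hclosed μ).completeSpace_coe
  choose w b hb using fun μ : ℂ => exists_hilbertBasis ℂ (Module.End.eigenspace (K : H →ₗ[ℂ] H) μ)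
  have hort := hs.orthogonalFamily_eigenspaces.orthonormal_sigma_orthonormal
    (fun μ => (b μ).orthonormal)
  have hbot : (Submodule.span ℂ (range fun a : Σ μ, w μ =>
      (Module.End.eigenspace (K : H →ₗ[ℂ] H) a.1).subtypeₗᵢ (b a.1 a.2)))ᗮ = ⊥ := by
    rw [eq_bot_iff, ← K.orthogonalComplement_iSup_eigenspaces_eq_bot hc hs]
    intro y hy
    rw [← Submodule.iInf_orthogonal, Submodule.mem_iInf]
    intro μ
    rw [Submodule.mem_orthogonal]
    intro x hx
    have h1 := ((b μ).hasSum_repr ⟨x, hx⟩).mapL (Submodule.subtypeL _)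
    have h2 := h1.mapL ((innerSL ℂ y))
    have h3 : ∀ i, inner ℂ y ((b μ i : Module.End.eigenspace (K : H →ₗ[ℂ] H) μ) : H) = 0 := by
      intro i
      rw [Submodule.mem_orthogonal'] at hy
      exact hy _ (Submodule.subset_span ⟨⟨μ, i⟩, rfl⟩)
    have h4 : inner ℂ y x = 0 := by
      refine h2.unique ?_
      simp [h3, hasSum_zero]
    exact inner_eq_zero_symm.1 h4
  refine ⟨Σ μ, w μ, HilbertBasis.mkOfOrthogonalEqBot hort hbot, fun a => a.1.re, fun a => ?_⟩
  rw [HilbertBasis.coe_mkOfOrthogonalEqBot]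
  have h1 : K (b a.1 a.2 : H) = a.1 • (b a.1 a.2 : H) :=
    Module.End.mem_eigenspace_iff.1 (b a.1 a.2).2
  have hne : Module.End.HasEigenvalue (K : H →ₗ[ℂ] H) a.1 := by
    refine Module.End.hasEigenvalue_of_hasEigenvector (x := (b a.1 a.2 : H)) ⟨(b a.1 a.2).2, ?_⟩
    intro h
    have := (b a.1).orthonormal.1 a.2
    rw [show b a.1 a.2 = 0 from Subtype.ext h] at this
    simp at this
  have h2 : ((a.1.re : ℝ) : ℂ) = a.1 := Complex.conj_eq_iff_re.1 (hs.conj_eigenvalue_eq_self hne)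
  rw [h2]
  exact h1

/-- The Peierls–Bogoliubov inequality: for convex `φ`, the sums of `φ (⟪e, K e⟫)` over orthonormal
families are controlled by the sums over orthonormal families of eigenvectors. -/
theorem sum_convex_inner_le_of_eigenvectors (K : H →L[ℂ] H) (hc : IsCompactOperator K)
    (hK : K.IsPositive) (φ φ' : ℝ → ℝ) (hφ0 : ∀ a, 0 ≤ a → 0 ≤ φ a)
    (hφ : ∀ a b, 0 ≤ a → 0 ≤ b → φ a + φ' a * (b - a) ≤ φ b) (C : ℝ)
    (hC : ∀ (ι : Type) [Fintype ι] (e : ι → H) (μ : ι → ℝ), Orthonormal ℂ e →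
      (∀ i, K (e i) = ((μ i : ℝ) : ℂ) • e i) → ∑ i, φ (μ i) ≤ C)
    {ι : Type} [Fintype ι] (e : ι → H) (he : Orthonormal ℂ e) :
    ∑ i, φ (inner ℂ (e i) (K (e i))).re ≤ C := by
  obtain ⟨κ, b, μ, hμ⟩ := exists_hilbertBasis_eigenvectors K hc hK.isSymmetric
  have hb1 : ∀ j, ‖b j‖ = 1 := b.orthonormal.1
  have hμ0 : ∀ j, 0 ≤ μ j := by
    intro j
    have := hK.re_inner_nonneg_right (b j)
    rw [hμ, inner_smul_right, inner_self_eq_norm_sq_to_K, hb1] at this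
    simpa using this
  have hsumle : ∀ s : Finset κ, ∑ j ∈ s, φ (μ j) ≤ C := by
    intro s
    have := hC s (fun i => b i) (fun i => μ i) (b.orthonormal.comp _ Subtype.val_injective)
      (fun i => hμ i)
    rwa [Finset.sum_coe_sort s (fun i => φ (μ i))] at this
  have hsφ : Summable fun j => φ (μ j) := summable_of_sum_le (fun j => hφ0 _ (hμ0 j)) hsumle
  have hsφ' : ∀ i, Summable fun j => φ (μ j) * ‖inner ℂ (b j) (e i)‖ ^ 2 := by
    intro i
    refine hsφ.of_nonneg_of_le (fun j => mul_nonneg (hφ0 _ (hμ0 j)) (sq_nonneg _)) fun j => ?_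
    refine mul_le_of_le_one_right (hφ0 _ (hμ0 j)) (pow_le_one₀ (norm_nonneg _) ?_)
    refine (norm_inner_le_norm _ _).trans ?_
    rw [hb1 j, he.1 i, one_mul]
  have hw : ∀ x : H, HasSum (fun j => ‖inner ℂ (b j) x‖ ^ 2) (‖x‖ ^ 2) := by
    intro x
    have := (b.hasSum_inner_mul_inner x x)
    have h2 := Complex.hasSum_re this
    rw [inner_self_eq_norm_sq_to_K] at h2
    convert h2 using 1
    · ext j
      rw [norm_inner_symm, ← inner_conj_symm (b j) x, Complex.mul_conj']
      norm_cast
    · norm_cast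
  have ha : ∀ x : H, HasSum (fun j => μ j * ‖inner ℂ (b j) x‖ ^ 2) (inner ℂ x (K x)).re := by
    intro x
    have := Complex.hasSum_re (b.hasSum_inner_mul_inner x (K x))
    convert this using 1
    ext j
    have h1 : inner ℂ (b j) (K x) = (μ j : ℂ) * inner ℂ (b j) x := by
      have := hK.isSymmetric (b j) x
      rw [ContinuousLinearMap.coe_coe, hμ, inner_smul_left, Complex.conj_ofReal] at this
      exact this.symm
    rw [h1, norm_inner_symm, ← inner_conj_symm (b j) x, mul_left_comm, Complex.mul_conj']
    norm_cast
  have hJ : ∀ i, φ (inner ℂ (e i) (K (e i))).re ≤ ∑' j, φ (μ j) * ‖inner ℂ (b j) (e i)‖ ^ 2 := by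
    intro i
    set a := (inner ℂ (e i) (K (e i))).re with hadef
    have ha0 : 0 ≤ a := hK.re_inner_nonneg_right (e i)
    have h1 : HasSum (fun j => (φ a - φ' a * a) * ‖inner ℂ (b j) (e i)‖ ^ 2
        + φ' a * (μ j * ‖inner ℂ (b j) (e i)‖ ^ 2)) ((φ a - φ' a * a) * 1 + φ' a * a) := by
      refine HasSum.add ?_ ((ha (e i)).mul_left _)
      have := (hw (e i)).mul_left (φ a - φ' a * a)
      simpa [he.1 i] using this
    have h2 : φ a = (φ a - φ' a * a) * 1 + φ' a * a := by ring
    rw [h2, ← h1.tsum_eq]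
    refine h1.summable.tsum_le_tsum (fun j => ?_) (hsφ' i)
    have := mul_le_mul_of_nonneg_right (hφ a (μ j) ha0 (hμ0 j))
      (sq_nonneg ‖inner ℂ (b j) (e i)‖)
    linarith
  calc ∑ i, φ (inner ℂ (e i) (K (e i))).re
      ≤ ∑ i, ∑' j, φ (μ j) * ‖inner ℂ (b j) (e i)‖ ^ 2 := Finset.sum_le_sum fun i _ => hJ i
    _ = ∑' j, ∑ i, φ (μ j) * ‖inner ℂ (b j) (e i)‖ ^ 2 :=
        (Summable.tsum_finsetSum fun i _ => hsφ' i).symm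
    _ ≤ ∑' j, φ (μ j) := by
        refine (summable_sum fun i _ => hsφ' i).tsum_le_tsum (fun j => ?_) hsφ
        rw [← Finset.mul_sum]
        refine mul_le_of_le_one_right (hφ0 _ (hμ0 j)) ?_
        have := he.sum_inner_products_le (b j) (s := Finset.univ)
        rw [hb1 j, one_pow] at this
        simpa [norm_inner_symm] using this
    _ ≤ C := hsφ.tsum_le_of_sum_le hsumle

theorem traceOfFun_le_of_eigenvectors (F : ℝ → ENNReal) (K : H →L[ℂ] H) (hc : IsCompactOperator K)
    (hs : K.IsSymmetric) (C : ENNReal)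
    (hC : ∀ (ι : Type) [Fintype ι] (e : ι → H) (μ : ι → ℝ), Orthonormal ℂ e → (∀ i, 0 < μ i) →
      (∀ i, K (e i) = ((μ i : ℝ) : ℂ) • e i) → ∑ i, F (μ i) ≤ C) :
    traceOfFun F K ≤ C := by
  rw [traceOfFun, ENNReal.tsum_eq_iSup_sum]
  refine iSup_le fun s => ?_
  have hfin : ∀ l : Ioi (0 : ℝ), FiniteDimensional ℂ
      (Module.End.eigenspace (K : H →ₗ[ℂ] H) ((l : ℝ) : ℂ)) := fun l =>
    K.finite_dimensional_eigenspace hc _ (by exact_mod_cast (ne_of_gt l.2))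
  have hort := (hs.orthogonalFamily_eigenspaces.comp
    (f := fun l : s => (((l : Ioi (0 : ℝ)) : ℝ) : ℂ)) (fun a b h => by
      exact Subtype.ext (Subtype.ext (Complex.ofReal_injective h)))).orthonormal_sigma_orthonormal
    (fun l => (stdOrthonormalBasis ℂ
      (Module.End.eigenspace (K : H →ₗ[ℂ] H) (((l : Ioi (0 : ℝ)) : ℝ) : ℂ))).orthonormal)
  have := hC _ _ (fun a => ((a.1 : Ioi (0 : ℝ)) : ℝ)) hort (fun a => mem_Ioi.1 a.1.1.2) (fun a =>
    Module.End.mem_eigenspace_iff.1 (stdOrthonormalBasis ℂ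
      (Module.End.eigenspace (K : H →ₗ[ℂ] H) (((a.1 : Ioi (0 : ℝ)) : ℝ) : ℂ)) a.2).2)
  refine le_trans (le_of_eq ?_) this
  rw [Fintype.sum_sigma, ← Finset.sum_coe_sort s]
  refine Finset.sum_congr rfl fun l _ => ?_
  have hrank : Cardinal.toENat (Module.rank ℂ (Module.End.eigenspace (K : H →ₗ[ℂ] H)
      (((l : Ioi (0 : ℝ)) : ℝ) : ℂ))) = Module.finrank ℂ (Module.End.eigenspace (K : H →ₗ[ℂ] H)
      (((l : Ioi (0 : ℝ)) : ℝ) : ℂ)) := by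
    rw [← Module.finrank_eq_rank, map_natCast]
  rw [hrank]
  simp

end HilbertSpace

section FourierL2

open scoped FourierTransform ENNReal NNReal

theorem exists_clm_apply_ae_eq {α : Type*} [MeasurableSpace α] {μ : Measure α}
    {E : Type*} [NormedAddCommGroup E] [NormedSpace ℂ E]
    {H : Type*} [NormedAddCommGroup H] [NormedSpace ℂ H]
    (B : H →L[ℂ] Lp E 2 μ) (Φ : α → E →L[ℂ] E) (hΦ : AEStronglyMeasurable Φ μ) (C : ℝ≥0)
    (h : ∀ u, eLpNorm (fun x => Φ x (B u x)) 2 μ ≤ C * ‖u‖ₑ) :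
    ∃ A : H →L[ℂ] Lp E 2 μ, ∀ u, ∀ᵐ x ∂μ, A u x = Φ x (B u x) := by
  have hm : ∀ u, MemLp (fun x => Φ x (B u x)) 2 μ := fun u =>
    ⟨(ContinuousLinearMap.apply ℂ E).flip.aestronglyMeasurable_comp₂ hΦ (Lp.aestronglyMeasurable _),
      (h u).trans_lt (ENNReal.mul_lt_top ENNReal.coe_lt_top enorm_lt_top)⟩
  let L : H →ₗ[ℂ] Lp E 2 μ :=
    { toFun := fun u => (hm u).toLp
      map_add' := by
        intro u v
        refine Lp.ext ?_
        filter_upwards [(hm (u + v)).coeFn_toLp, (hm u).coeFn_toLp, (hm v).coeFn_toLp,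
          Lp.coeFn_add (hm u).toLp (hm v).toLp, Lp.coeFn_add (B u) (B v)] with x h1 h2 h3 h4 h5
        rw [h1, h4, Pi.add_apply, h2, h3, map_add, h5, Pi.add_apply, map_add]
      map_smul' := by
        intro c u
        refine Lp.ext ?_
        filter_upwards [(hm (c • u)).coeFn_toLp, (hm u).coeFn_toLp,
          Lp.coeFn_smul c (hm u).toLp, Lp.coeFn_smul c (B u)] with x h1 h2 h4 h5
        rw [h1, RingHom.id_apply, h4, Pi.smul_apply, h2, map_smul, h5, Pi.smul_apply, map_smul] }
  refine ⟨L.mkContinuous C fun u => ?_, fun u => (hm u).coeFn_toLp⟩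
  change ‖(hm u).toLp‖ ≤ _
  rw [Lp.norm_toLp]
  refine ENNReal.toReal_le_of_le_ofReal (by positivity) ((h u).trans (le_of_eq ?_))
  rw [ENNReal.ofReal_mul (by positivity), ofReal_norm]
  simp

variable {d : ℕ} {E : Type*} [NormedAddCommGroup E] [InnerProductSpace ℂ E] [CompleteSpace E]

theorem fourier_Lp_two_ae_eq (u : Lp E 2 (volume : Measure (Space d)))
    (hu : Integrable (u : Space d → E)) :
    ((𝓕 u : Lp E 2 (volume : Measure (Space d))) : Space d → E) =ᵐ[volume]
      𝓕 (u : Space d → E) := by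
  have hcont : Continuous (𝓕 (u : Space d → E)) :=
    VectorFourier.fourierIntegral_continuous Real.continuous_fourierChar
      (by exact continuous_inner) hu
  refine ae_eq_of_integral_contDiff_smul_eq
    ((Lp.memLp _).locallyIntegrable (by norm_num)) hcont.locallyIntegrable ?_
  intro g hg hgc
  have hg₁ : HasCompactSupport (Complex.ofRealCLM ∘ g) := hgc.comp_left rfl
  have hg₂ : ContDiff ℝ (⊤ : ℕ∞) (Complex.ofRealCLM ∘ g) := by
    exact Complex.ofRealCLM.contDiff.comp hg
  set G := hg₁.toSchwartzMap hg₂ with hG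
  have h1 := congrArg (fun T => T G) (Lp.fourier_toTemperedDistribution_eq u)
  simp only [TemperedDistribution.fourier_apply, Lp.toTemperedDistribution_apply] at h1
  have h2 := VectorFourier.integral_fourierIntegral_smul_eq_flip (L := innerₗ (Space d))
      (μ := volume) (ν := volume)
      Real.continuous_fourierChar continuous_inner (G.integrable (μ := volume)) hu
  have h3 : ∀ x, (G x : ℂ) = (g x : ℂ) := fun x => rfl
  calc ∫ x, g x • (𝓕 u : Lp E 2 (volume : Measure (Space d))) x
      = ∫ x, G x • (𝓕 u : Lp E 2 (volume : Measure (Space d))) x := by simp [h3]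
    _ = ∫ x, (𝓕 G) x • u x := h1.symm
    _ = ∫ x, G x • 𝓕 (u : Space d → E) x := by
        simpa [Real.fourier_eq, SchwartzMap.fourier_coe] using! h2
    _ = _ := by simp [h3]

theorem fourierInv_Lp_two_ae_eq (u : Lp E 2 (volume : Measure (Space d)))
    (hu : Integrable (u : Space d → E)) :
    ((𝓕⁻ u : Lp E 2 (volume : Measure (Space d))) : Space d → E) =ᵐ[volume]
      𝓕⁻ (u : Space d → E) := by
  have hcont : Continuous (𝓕⁻ (u : Space d → E)) :=
    VectorFourier.fourierIntegral_continuous Real.continuous_fourierChar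
      (by exact continuous_inner.neg) hu
  refine ae_eq_of_integral_contDiff_smul_eq
    ((Lp.memLp _).locallyIntegrable (by norm_num)) hcont.locallyIntegrable ?_
  intro g hg hgc
  have hg₁ : HasCompactSupport (Complex.ofRealCLM ∘ g) := hgc.comp_left rfl
  have hg₂ : ContDiff ℝ (⊤ : ℕ∞) (Complex.ofRealCLM ∘ g) := by
    exact Complex.ofRealCLM.contDiff.comp hg
  set G := hg₁.toSchwartzMap hg₂ with hG
  have h1 := congrArg (fun T => T G) (Lp.fourierInv_toTemperedDistribution_eq u)
  simp only [TemperedDistribution.fourierInv_apply, Lp.toTemperedDistribution_apply] at h1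
  have h2 := VectorFourier.integral_fourierIntegral_smul_eq_flip (L := -innerₗ (Space d))
      (μ := volume) (ν := volume)
      Real.continuous_fourierChar continuous_inner.neg (G.integrable (μ := volume)) hu
  have h3 : ∀ x, (G x : ℂ) = (g x : ℂ) := fun x => rfl
  calc ∫ x, g x • (𝓕⁻ u : Lp E 2 (volume : Measure (Space d))) x
      = ∫ x, G x • (𝓕⁻ u : Lp E 2 (volume : Measure (Space d))) x := by simp [h3]
    _ = ∫ x, (𝓕⁻ G) x • u x := h1.symm
    _ = ∫ x, G x • 𝓕⁻ (u : Space d → E) x := by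
        have hflip : (-innerₗ (Space d)).flip = -innerₗ (Space d) := by
          ext x y; simp [real_inner_comm]
        rw [hflip] at h2
        rw [SchwartzMap.fourierInv_coe]
        exact h2
    _ = _ := by simp [h3]

end FourierL2

section MultiplicationFourier

open scoped FourierTransform ENNReal NNReal

variable {d N : ℕ}

theorem integrable_of_ae_eq_apply {W : Space d → EuclideanSpace ℂ (Fin N) →L[ℂ] EuclideanSpace ℂ (Fin N)}
    (hW : MemLp W 2 volume) (u w : L2 d N) (hw : ∀ᵐ x, w x = W x (u x)) :
    Integrable (w : Space d → EuclideanSpace ℂ (Fin N)) := by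
  have h : Integrable (fun x => ‖W x‖ * ‖u x‖) :=
    MemLp.integrable_mul (p := 2) (q := 2) hW.norm (Lp.memLp u).norm
  refine h.mono' (Lp.aestronglyMeasurable _) ?_
  filter_upwards [hw] with x hx
  rw [hx]
  exact (W x).le_opNorm _

/-- Bessel's inequality for the Fourier transforms of `W u`, with a bound which is uniform in the
frequency. -/
theorem exists_sum_norm_fourier_sq_le
    {W : Space d → EuclideanSpace ℂ (Fin N) →L[ℂ] EuclideanSpace ℂ (Fin N)}
    (hW : MemLp W 2 volume) (hsymm : ∀ x a b, inner ℂ (W x a) b = inner ℂ a (W x b))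
    (M : L2 d N →L[ℂ] L2 d N) (hM : ∀ u, ∀ᵐ x, M u x = W x (u x)) :
    ∃ C : ℝ, 0 ≤ C ∧ ∀ (ι : Type) [Fintype ι] (e : ι → L2 d N), Orthonormal ℂ e →
      ∀ᵐ p, ∑ k, ‖(𝓕 (M (e k)) : L2 d N) p‖ ^ 2 ≤ C := by
  let b := EuclideanSpace.basisFun (Fin N) ℂ
  have hk : ∀ (p : Space d) (i : Fin N),
      MemLp (fun x => Real.fourierChar (inner ℝ x p) • W x (b i)) 2 volume := by
    intro p i
    have h1 : MemLp (fun x => W x (b i)) 2 volume :=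
      (ContinuousLinearMap.apply ℂ (EuclideanSpace ℂ (Fin N)) (b i)).comp_memLp' hW
    refine h1.of_le ?_ (Filter.Eventually.of_forall fun x => by simp)
    refine AEStronglyMeasurable.smul ?_ h1.1
    exact (continuous_subtype_val.comp (Real.continuous_fourierChar.comp
      (continuous_id.inner (continuous_const (y := p))))).aestronglyMeasurable
  have hnorm : ∀ p i, ‖(hk p i).toLp‖ = ‖(hk 0 i).toLp‖ := by
    intro p i
    rw [Lp.norm_toLp, Lp.norm_toLp]
    congr 1
    refine eLpNorm_congr_norm_ae (Filter.Eventually.of_forall fun x => ?_)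
    simp
  refine ⟨∑ i, ‖(hk 0 i).toLp‖ ^ 2, by positivity, fun ι _ e he => ?_⟩
  have hF : ∀ k, ∀ᵐ p, (𝓕 (M (e k)) : L2 d N) p = 𝓕 (M (e k) : Space d → _) p := fun k =>
    fourier_Lp_two_ae_eq _ (integrable_of_ae_eq_apply hW (e k) _ (hM (e k)))
  rw [← ae_all_iff] at hF
  filter_upwards [hF] with p hp
  have hcoef : ∀ k i, inner ℂ (b i) ((𝓕 (M (e k)) : L2 d N) p) = inner ℂ (hk p i).toLp (e k) := by
    intro k i
    rw [hp k, Real.fourier_eq, L2.inner_def]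
    have hint : Integrable (fun x => Real.fourierChar (-inner ℝ x p) • M (e k) x) :=
      (Real.fourierIntegral_convergent_iff p).2
        (integrable_of_ae_eq_apply hW (e k) _ (hM (e k)))
    rw [← integral_inner hint]
    refine integral_congr_ae ?_
    filter_upwards [hM (e k), (hk p i).coeFn_toLp] with x hx hx2
    rw [hx, hx2, Circle.smul_def, Circle.smul_def, inner_smul_left, inner_smul_right, hsymm]
    congr 1
    rw [AddChar.map_neg_eq_inv, Circle.coe_inv_eq_conj]
  calc ∑ k, ‖(𝓕 (M (e k)) : L2 d N) p‖ ^ 2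
      = ∑ k, ∑ i, ‖inner ℂ (hk p i).toLp (e k)‖ ^ 2 := by
        refine Finset.sum_congr rfl fun k _ => ?_
        rw [← b.sum_sq_norm_inner_right]
        exact Finset.sum_congr rfl fun i _ => by rw [hcoef]
    _ = ∑ i, ∑ k, ‖inner ℂ (e k) (hk p i).toLp‖ ^ 2 := by
        rw [Finset.sum_comm]
        exact Finset.sum_congr rfl fun i _ => Finset.sum_congr rfl fun k _ => by
          rw [norm_inner_symm]
    _ ≤ ∑ i, ‖(hk p i).toLp‖ ^ 2 :=
        Finset.sum_le_sum fun i _ => he.sum_inner_products_le _ (s := Finset.univ)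
    _ = _ := by simp only [hnorm]

theorem norm_fourier_sq_le_of_orthonormal_bound (M : L2 d N →L[ℂ] L2 d N) {C : ℝ}
    (hC : ∀ (ι : Type) [Fintype ι] (e : ι → L2 d N), Orthonormal ℂ e →
      ∀ᵐ p, ∑ k, ‖(𝓕 (M (e k)) : L2 d N) p‖ ^ 2 ≤ C) (u : L2 d N) :
    ∀ᵐ p, ‖(𝓕 (M u) : L2 d N) p‖ ^ 2 ≤ C * ‖u‖ ^ 2 := by
  rcases eq_or_ne u 0 with rfl | hu
  · have : (𝓕 (M 0) : L2 d N) = 0 := by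
      rw [map_zero]; exact (Lp.fourierTransformₗᵢ (Space d) (EuclideanSpace ℂ (Fin N))).map_zero
    rw [this]
    filter_upwards [Lp.coeFn_zero (EuclideanSpace ℂ (Fin N)) 2 (volume : Measure (Space d))]
      with p hp
    simp
  · have hn : (‖u‖ : ℂ) ≠ 0 := by exact_mod_cast norm_ne_zero_iff.2 hu
    have horth : Orthonormal ℂ (fun _ : Unit => ((‖u‖ : ℂ)⁻¹) • u) := by
      refine ⟨fun _ => ?_, fun i j h => (h rfl).elim⟩
      rw [norm_smul, norm_inv, Complex.norm_real, norm_norm,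
        inv_mul_cancel₀ (norm_ne_zero_iff.2 hu)]
    have h1 := hC Unit _ horth
    have h2 : (𝓕 (M ((‖u‖ : ℂ)⁻¹ • u)) : L2 d N) = (‖u‖ : ℂ)⁻¹ • (𝓕 (M u) : L2 d N) := by
      rw [map_smul]
      exact (Lp.fourierTransformₗᵢ (Space d) (EuclideanSpace ℂ (Fin N))).map_smul _ _
    rw [h2] at h1
    filter_upwards [h1, Lp.coeFn_smul ((‖u‖ : ℂ)⁻¹) (𝓕 (M u) : L2 d N)] with p hp1 hp2
    simp only [Finset.univ_unique, Finset.sum_singleton] at hp1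
    rw [hp2, Pi.smul_apply, norm_smul, norm_inv, Complex.norm_real, norm_norm, mul_pow, inv_pow,
      inv_mul_le_iff₀ (by positivity)] at hp1
    linarith

end MultiplicationFourier

section BirmanSchwinger

open scoped FourierTransform ENNReal NNReal

theorem eLpNorm_two_sq {α E : Type*} [MeasurableSpace α] {μ : Measure α} [NormedAddCommGroup E]
    (f : α → E) : eLpNorm f 2 μ ^ 2 = ∫⁻ x, ‖f x‖ₑ ^ 2 ∂μ := by
  rw [eLpNorm_eq_lintegral_rpow_enorm_toReal (by norm_num) (by norm_num)]
  rw [← ENNReal.rpow_natCast, ← ENNReal.rpow_mul]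
  simp

theorem enorm_sq_Lp_two {α E : Type*} [MeasurableSpace α] {μ : Measure α} [NormedAddCommGroup E]
    (u : Lp E 2 μ) : ‖u‖ₑ ^ 2 = ∫⁻ x, ‖u x‖ₑ ^ 2 ∂μ := by
  rw [Lp.enorm_def, eLpNorm_two_sq]

theorem enorm_sq_le_of_norm_sq_le {E F : Type*} [NormedAddCommGroup E] [NormedAddCommGroup F]
    {a : E} {b : F} {C : ℝ} (hC : 0 ≤ C)
    (h : ‖a‖ ^ 2 ≤ C * ‖b‖ ^ 2) : ‖a‖ₑ ^ 2 ≤ ENNReal.ofReal C * ‖b‖ₑ ^ 2 := by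
  have := ENNReal.ofReal_le_ofReal h
  rwa [ENNReal.ofReal_mul hC, ENNReal.ofReal_pow (norm_nonneg _),
    ENNReal.ofReal_pow (norm_nonneg _), ofReal_norm, ofReal_norm] at this

variable {d N : ℕ}

theorem ae_ne_zero_space (hd : 0 < d) : ∀ᵐ p : Space d, p ≠ 0 := by
  have : Nonempty (Fin d) := ⟨⟨0, hd⟩⟩
  exact compl_mem_ae_iff.2 (measure_singleton (0 : Space d))

theorem lintegral_ball_inv_norm_sq_lt_top (hd : 3 ≤ d) (R : ℝ) :
    ∫⁻ p in Metric.ball (0 : Space d) R, ‖((2 * Real.pi * ‖p‖ : ℝ) : ℂ)⁻¹‖ₑ ^ 2 < ∞ := by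
  have : Nonempty (Fin d) := ⟨⟨0, by omega⟩⟩
  have h1 : IntegrableOn (fun p : Space d => (fun y : ℝ => (2 * Real.pi * y)⁻¹ ^ 2) ‖p‖)
      (Metric.ball (0 : Space d) R) := by
    refine (integrableOn_fun_norm_addHaar (volume : Measure (Space d))
      (f := fun y : ℝ => (2 * Real.pi * y)⁻¹ ^ 2)).2 ?_
    have h2 : IntegrableOn (fun y : ℝ => y ^ (d - 3) * ((2 * Real.pi)⁻¹ ^ 2)) (Ioo 0 R) :=
      (Continuous.integrableOn_Icc (by fun_prop)).mono_set Ioo_subset_Icc_self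
    refine h2.congr_fun (fun y hy => ?_) measurableSet_Ioo
    have hy0 : y ≠ 0 := hy.1.ne'
    have h3 : Module.finrank ℝ (Space d) - 1 = (d - 3) + 2 := by
      rw [finrank_euclideanSpace_fin]; omega
    rw [h3, pow_add]
    simp only [smul_eq_mul]
    field_simp
  have h2 := h1.lintegral_lt_top
  refine lt_of_le_of_lt (le_of_eq ?_) h2
  refine lintegral_congr fun p => ?_
  rw [← ofReal_norm, ← ENNReal.ofReal_pow (norm_nonneg _), norm_inv, Complex.norm_real,
    Real.norm_of_nonneg (by positivity)]

theorem aestronglyMeasurable_smul_id {E : Type*} [NormedAddCommGroup E] [NormedSpace ℂ E]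
    {α : Type*} [MeasurableSpace α] {μ : Measure α} {k : α → ℂ} (hk : AEStronglyMeasurable k μ) :
    AEStronglyMeasurable (fun p => k p • ContinuousLinearMap.id ℂ E) μ :=
  hk.smul_const _

/-- The operator `A = (-Δ)^{-1/2} W` is bounded. -/
theorem exists_invSqrtLaplacian (hd : 3 ≤ d) (M : L2 d N →L[ℂ] L2 d N) {C : ℝ} (hC0 : 0 ≤ C)
    (hC : ∀ u, ∀ᵐ p, ‖(𝓕 (M u) : L2 d N) p‖ ^ 2 ≤ C * ‖u‖ ^ 2) :
    ∃ A : L2 d N →L[ℂ] L2 d N, ∀ u, IsInvSqrtLaplacian (M u) (A u) := by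
  let F := (Lp.fourierTransformₗᵢ (Space d) (EuclideanSpace ℂ (Fin N)))
  let FL : L2 d N →L[ℂ] L2 d N := F.toContinuousLinearEquiv
  let k : Space d → ℂ := fun p => ((2 * Real.pi * ‖p‖ : ℝ) : ℂ)⁻¹
  have hk : Measurable k := by fun_prop
  set I := ∫⁻ p in Metric.ball (0 : Space d) 1, ‖k p‖ₑ ^ 2 with hI
  have hIlt : I < ∞ := lintegral_ball_inv_norm_sq_lt_top hd 1
  let D : ℝ≥0∞ := I * ENNReal.ofReal C + ‖M‖ₑ ^ 2
  have hD : D < ∞ := ENNReal.add_lt_top.2 ⟨ENNReal.mul_lt_top hIlt ENNReal.ofReal_lt_top,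
    ENNReal.pow_lt_top enorm_lt_top⟩
  have hbound : ∀ u, eLpNorm (fun x => (k x • ContinuousLinearMap.id ℂ (EuclideanSpace ℂ (Fin N)))
      ((FL ∘L M) u x)) 2 volume ≤ ((D ^ (1 / 2 : ℝ)).toNNReal : ℝ≥0∞) * ‖u‖ₑ := by
    intro u
    rw [ENNReal.coe_toNNReal (ENNReal.rpow_ne_top_of_nonneg (by norm_num) hD.ne)]
    rw [← ENNReal.pow_le_pow_left_iff (n := 2) (by norm_num), eLpNorm_two_sq, mul_pow,
      ← ENNReal.rpow_natCast, ← ENNReal.rpow_mul]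
    norm_num
    have hle : ∀ᵐ p, ‖k p • (𝓕 (M u) : L2 d N) p‖ₑ ^ 2 ≤
        (Metric.ball (0 : Space d) 1).indicator (fun p => ‖k p‖ₑ ^ 2) p *
          (ENNReal.ofReal C * ‖u‖ₑ ^ 2) + ‖(𝓕 (M u) : L2 d N) p‖ₑ ^ 2 := by
      filter_upwards [hC u] with p hp
      have hp' := enorm_sq_le_of_norm_sq_le hC0 hp
      by_cases hpb : p ∈ Metric.ball (0 : Space d) 1
      · rw [indicator_of_mem hpb, enorm_smul, mul_pow]
        exact le_add_right (by gcongr)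
      · rw [indicator_of_notMem hpb, zero_mul, zero_add, enorm_smul, mul_pow]
        refine mul_le_of_le_one_left zero_le (pow_le_one₀ zero_le ?_)
        have h1 : 1 ≤ ‖p‖ := by simpa using hpb
        rw [← ofReal_norm, ENNReal.ofReal_le_one, norm_inv, Complex.norm_real,
          Real.norm_of_nonneg (by positivity)]
        refine inv_le_one_of_one_le₀ ?_
        nlinarith [Real.pi_gt_three]
    calc ∫⁻ p, ‖k p • (𝓕 (M u) : L2 d N) p‖ₑ ^ 2
        ≤ ∫⁻ p, ((Metric.ball (0 : Space d) 1).indicator (fun p => ‖k p‖ₑ ^ 2) p *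
          (ENNReal.ofReal C * ‖u‖ₑ ^ 2) + ‖(𝓕 (M u) : L2 d N) p‖ₑ ^ 2) := lintegral_mono_ae hle
      _ = I * (ENNReal.ofReal C * ‖u‖ₑ ^ 2) + ‖M u‖ₑ ^ 2 := by
          have hmeas : Measurable fun p => (Metric.ball (0 : Space d) 1).indicator
              (fun p => ‖k p‖ₑ ^ 2) p :=
            (hk.enorm.pow_const 2).indicator measurableSet_ball
          rw [lintegral_add_left (hmeas.mul_const _), lintegral_mul_const _ hmeas,
            lintegral_indicator measurableSet_ball, ← enorm_sq_Lp_two]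
          congr 2
          exact enorm_eq_iff_norm_eq.2 (F.norm_map (M u))
      _ ≤ D * ‖u‖ₑ ^ 2 := by
          rw [add_mul, mul_assoc, ← mul_pow]
          gcongr
          exact M.le_opENorm u
  obtain ⟨A, hA⟩ := exists_clm_apply_ae_eq (FL ∘L M)
    (fun p => k p • ContinuousLinearMap.id ℂ (EuclideanSpace ℂ (Fin N)))
    (aestronglyMeasurable_smul_id hk.aestronglyMeasurable) _ hbound
  refine ⟨(F.symm.toContinuousLinearEquiv : L2 d N →L[ℂ] L2 d N) ∘L A, fun u => ?_⟩
  have h1 : (𝓕 (((F.symm.toContinuousLinearEquiv : L2 d N →L[ℂ] L2 d N) ∘L A) u) : L2 d N)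
      = A u := F.apply_symm_apply (A u)
  have hne := ae_ne_zero_space (d := d) (by omega)
  rw [IsInvSqrtLaplacian, h1]
  filter_upwards [hA u, hne] with p hp hp0
  rw [hp]
  have : ((2 * Real.pi * ‖p‖ : ℝ) : ℂ) ≠ 0 := by
    have := norm_ne_zero_iff.2 hp0
    exact_mod_cast by positivity
  simp only [k, smul_apply, ContinuousLinearMap.id_apply, smul_smul]
  rw [mul_inv_cancel₀ this, one_smul]
  rfl

/-- If `W u` has a Fourier transform which is bounded by a multiple of `‖u‖` in the sense of
Bessel's inequality, then `(-Δ)^{-1/2} W` is compact. -/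
theorem isCompactOperator_invSqrtLaplacian (hd : 3 ≤ d) (M A : L2 d N →L[ℂ] L2 d N) {C : ℝ}
    (hC : ∀ (ι : Type) [Fintype ι] (e : ι → L2 d N), Orthonormal ℂ e →
      ∀ᵐ p, ∑ k, ‖(𝓕 (M (e k)) : L2 d N) p‖ ^ 2 ≤ C)
    (hA : ∀ u, IsInvSqrtLaplacian (M u) (A u)) : IsCompactOperator A := by
  let F := (Lp.fourierTransformₗᵢ (Space d) (EuclideanSpace ℂ (Fin N)))
  let FL : L2 d N →L[ℂ] L2 d N := F.toContinuousLinearEquiv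
  let FI : L2 d N →L[ℂ] L2 d N := F.symm.toContinuousLinearEquiv
  let χ : ℕ → Space d → ℂ := fun n => (Metric.ball (0 : Space d) n).indicator 1
  have hχ : ∀ n, Measurable (χ n) := fun n => measurable_one.indicator measurableSet_ball
  have hne := ae_ne_zero_space (d := d) (by omega)
  have hA' : ∀ u, ∀ᵐ p, (𝓕 (A u) : L2 d N) p =
      ((2 * Real.pi * ‖p‖ : ℝ) : ℂ)⁻¹ • (𝓕 (M u) : L2 d N) p := by
    intro u
    filter_upwards [hA u, hne] with p hp hp0
    have : ((2 * Real.pi * ‖p‖ : ℝ) : ℂ) ≠ 0 := by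
      have := norm_ne_zero_iff.2 hp0
      exact_mod_cast by positivity
    rw [hp, smul_smul, inv_mul_cancel₀ this, one_smul]
  have hex : ∀ n, ∃ B : L2 d N →L[ℂ] L2 d N, ∀ u, ∀ᵐ p, B u p =
      (χ n p • ContinuousLinearMap.id ℂ (EuclideanSpace ℂ (Fin N))) ((FL ∘L A) u p) := by
    intro n
    refine exists_clm_apply_ae_eq (FL ∘L A) _
      (aestronglyMeasurable_smul_id (hχ n).aestronglyMeasurable) ‖FL ∘L A‖₊ fun u => ?_
    refine le_trans ?_ ((FL ∘L A).le_opENorm u)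
    rw [Lp.enorm_def]
    refine eLpNorm_mono fun p => ?_
    simp only [smul_apply, ContinuousLinearMap.id_apply, norm_smul]
    refine mul_le_of_le_one_left (norm_nonneg _) ?_
    by_cases hp : p ∈ Metric.ball (0 : Space d) n <;> simp [χ, hp]
  choose B hB using hex
  have hBc : ∀ n, IsCompactOperator (B n) := by
    intro n
    set I := ∫⁻ p in Metric.ball (0 : Space d) n, ‖((2 * Real.pi * ‖p‖ : ℝ) : ℂ)⁻¹‖ₑ ^ 2 with hI
    have hIlt : I < ∞ := lintegral_ball_inv_norm_sq_lt_top hd n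
    refine isCompactOperator_of_sum_norm_sq_le (B n) (I * ENNReal.ofReal C).toReal ?_
    intro ι _ e he
    have key : ∑ i, ‖B n (e i)‖ₑ ^ 2 ≤ I * ENNReal.ofReal C := by
      have hkm : Measurable fun p : Space d => ((2 * Real.pi * ‖p‖ : ℝ) : ℂ)⁻¹ := by fun_prop
      calc ∑ i, ‖B n (e i)‖ₑ ^ 2
          = ∫⁻ p, ∑ i, ‖B n (e i) p‖ₑ ^ 2 := by
            rw [lintegral_finsetSum' _ fun i _ =>
              (Lp.aestronglyMeasurable _).enorm.pow_const _]
            exact Finset.sum_congr rfl fun i _ => enorm_sq_Lp_two _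
        _ ≤ ∫⁻ p, (Metric.ball (0 : Space d) n).indicator
              (fun p => ‖((2 * Real.pi * ‖p‖ : ℝ) : ℂ)⁻¹‖ₑ ^ 2 * ENNReal.ofReal C) p := by
            refine lintegral_mono_ae ?_
            have hB' := ae_all_iff.2 fun i => hB n (e i)
            have hA'' := ae_all_iff.2 fun i => hA' (e i)
            filter_upwards [hB', hA'', hC ι e he] with p h1 h2 h3
            by_cases hp : p ∈ Metric.ball (0 : Space d) n
            · rw [indicator_of_mem hp]
              have : ∀ i, ‖B n (e i) p‖ₑ ^ 2 = ‖((2 * Real.pi * ‖p‖ : ℝ) : ℂ)⁻¹‖ₑ ^ 2 *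
                  ENNReal.ofReal (‖(𝓕 (M (e i)) : L2 d N) p‖ ^ 2) := by
                intro i
                have h4 : (FL ∘L A) (e i) p = (𝓕 (A (e i)) : L2 d N) p := rfl
                rw [h1 i, h4, h2 i]
                simp only [χ, indicator_of_mem hp, Pi.one_apply, one_smul,
                  ContinuousLinearMap.id_apply]
                rw [enorm_smul, mul_pow, ENNReal.ofReal_pow (norm_nonneg _), ofReal_norm]
              simp only [this]
              rw [← Finset.mul_sum, ← ENNReal.ofReal_sum_of_nonneg fun i _ => sq_nonneg _]
              gcongr
            · rw [indicator_of_notMem hp]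
              have : ∀ i, ‖B n (e i) p‖ₑ ^ 2 = 0 := by
                intro i
                rw [h1 i]
                simp [χ, indicator_of_notMem hp]
              simp [this]
        _ = I * ENNReal.ofReal C := by
            rw [lintegral_indicator measurableSet_ball, lintegral_mul_const]
            exact hkm.enorm.pow_const 2
    have h5 : (∑ i, ‖B n (e i)‖ₑ ^ 2).toReal = ∑ i, ‖B n (e i)‖ ^ 2 := by
      rw [ENNReal.toReal_sum fun i _ => (ENNReal.pow_lt_top enorm_lt_top).ne]
      simp
    rw [← h5]
    exact ENNReal.toReal_mono (ENNReal.mul_lt_top hIlt ENNReal.ofReal_lt_top).ne key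
  have hFA : IsCompactOperator (FL ∘L A) := by
    refine isCompactOperator_of_tendsto (l := Filter.atTop) (F := B) ?_
      (Filter.Eventually.of_forall hBc)
    rw [tendsto_iff_norm_sub_tendsto_zero]
    have hlim : Filter.Tendsto (fun n : ℕ => ‖M‖ / (n : ℝ)) Filter.atTop (nhds 0) :=
      tendsto_const_div_atTop_nhds_zero_nat _
    refine squeeze_zero' (Filter.Eventually.of_forall fun _ => norm_nonneg _) ?_ hlim
    filter_upwards [Filter.eventually_gt_atTop 0] with n hn
    have hn' : (0 : ℝ) < n := by exact_mod_cast hn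
    refine ContinuousLinearMap.opNorm_le_bound _ (by positivity) fun u => ?_
    have h6 : ‖(B n - FL ∘L A) u‖ ≤ (n : ℝ)⁻¹ * ‖FL (M u)‖ := by
      refine Lp.norm_le_mul_norm_of_ae_le_mul ?_
      have h7 : (B n - FL ∘L A) u = B n u - (FL ∘L A) u := rfl
      rw [h7]
      filter_upwards [Lp.coeFn_sub (B n u) ((FL ∘L A) u), hB n u, hA' u] with p h8 h9 h10
      have h4 : (FL ∘L A) u p = (𝓕 (A u) : L2 d N) p := rfl
      have h4' : FL (M u) p = (𝓕 (M u) : L2 d N) p := rfl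
      rw [h8, Pi.sub_apply, h9, h4, h4']
      by_cases hp : p ∈ Metric.ball (0 : Space d) n
      · simp only [χ, indicator_of_mem hp, Pi.one_apply, one_smul, ContinuousLinearMap.id_apply,
          sub_self, norm_zero]
        positivity
      · have h12 : χ n p = 0 := indicator_of_notMem hp _
        rw [h12, smul_apply, zero_smul, zero_sub, norm_neg, h10, norm_smul, norm_inv, Complex.norm_real, Real.norm_of_nonneg (by positivity)]
        have h1 : (n : ℝ) ≤ ‖p‖ := by simpa using hp
        gcongr
        nlinarith [Real.pi_gt_three]
    have h11 : ‖FL (M u)‖ = ‖M u‖ := F.norm_map (M u)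
    rw [h11] at h6
    refine h6.trans ?_
    rw [div_mul_eq_mul_div, div_eq_inv_mul]
    gcongr
    exact M.le_opNorm u
  have : A = FI ∘L (FL ∘L A) := by
    ext1 u
    exact (F.symm_apply_apply (A u)).symm
  rw [this]
  exact hFA.clm_comp FI

end BirmanSchwinger

section MatrixPotential

open scoped ENNReal

variable {N : ℕ}

theorem toEuclideanCLM_cfc_eigenvectorBasis {B : Matrix (Fin N) (Fin N) ℂ} (hB : B.IsHermitian)
    (f : ℝ → ℝ) (j : Fin N) :
    Matrix.toEuclideanCLM (𝕜 := ℂ) (cfc f B) (hB.eigenvectorBasis j) =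
      ((f (hB.eigenvalues j) : ℝ) : ℂ) • hB.eigenvectorBasis j := by
  apply WithLp.ofLp_injective
  rw [Matrix.ofLp_toEuclideanCLM, hB.cfc_eq, Matrix.IsHermitian.cfc,
    Unitary.conjStarAlgAut_apply, ← Matrix.mulVec_mulVec, ← Matrix.mulVec_mulVec]
  have h1 := hB.star_eigenvectorUnitary_mulVec j
  have h2 := hB.eigenvectorUnitary_mulVec j
  rw [h1]
  have h3 : (Matrix.diagonal (RCLike.ofReal ∘ f ∘ hB.eigenvalues) : Matrix (Fin N) (Fin N) ℂ).mulVec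
      (Pi.single j 1) = ((f (hB.eigenvalues j) : ℝ) : ℂ) • Pi.single j 1 := by
    simp
    rw [← Pi.single_smul]
    simp
  rw [h3, Matrix.mulVec_smul, h2]
  rfl

theorem trace_cfc_eq_sum {B : Matrix (Fin N) (Fin N) ℂ} (hB : B.IsHermitian) (f : ℝ → ℝ) :
    (cfc f B).trace.re = ∑ j, f (hB.eigenvalues j) := by
  rw [hB.cfc_eq, Matrix.IsHermitian.cfc, Unitary.conjStarAlgAut_apply, Matrix.trace_mul_comm,
    ← mul_assoc]
  simp [Matrix.trace]

/-- An operator which is diagonal with real eigenvalues is symmetric. -/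
theorem inner_symm_of_orthonormalBasis {E : Type*} [NormedAddCommGroup E] [InnerProductSpace ℂ E]
    {ι : Type*} [Fintype ι] (b : OrthonormalBasis ι ℂ E) (T : E →L[ℂ] E) (w : ι → ℝ)
    (hT : ∀ j, T (b j) = ((w j : ℝ) : ℂ) • b j) (x y : E) :
    inner ℂ (T x) y = inner ℂ x (T y) := by
  have h1 : ∀ z, T z = ∑ j, (inner ℂ (b j) z * (w j : ℂ)) • b j := by
    intro z
    conv_lhs => rw [← b.sum_repr' z, map_sum]
    exact Finset.sum_congr rfl fun j _ => by rw [map_smul, hT, smul_smul]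
  rw [h1, h1 y, sum_inner, inner_sum]
  refine Finset.sum_congr rfl fun j _ => ?_
  rw [inner_smul_left, inner_smul_right, map_mul, Complex.conj_ofReal, inner_conj_symm]
  ring

theorem norm_sq_apply_of_orthonormalBasis {E : Type*} [NormedAddCommGroup E]
    [InnerProductSpace ℂ E]
    {ι : Type*} [Fintype ι] (b : OrthonormalBasis ι ℂ E) (T : E →L[ℂ] E) (w : ι → ℝ)
    (hT : ∀ j, T (b j) = ((w j : ℝ) : ℂ) • b j) (x : E) :
    ‖T x‖ ^ 2 = ∑ j, w j ^ 2 * ‖inner ℂ (b j) x‖ ^ 2 := by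
  rw [← b.sum_sq_norm_inner_right]
  refine Finset.sum_congr rfl fun j _ => ?_
  rw [← inner_symm_of_orthonormalBasis b T w hT, hT, inner_smul_left, norm_mul, mul_pow]
  simp

theorem norm_sq_le_of_orthonormalBasis {E : Type*} [NormedAddCommGroup E]
    [InnerProductSpace ℂ E]
    {ι : Type*} [Fintype ι] (b : OrthonormalBasis ι ℂ E) (T : E →L[ℂ] E) (w : ι → ℝ)
    (hT : ∀ j, T (b j) = ((w j : ℝ) : ℂ) • b j) : ‖T‖ ^ 2 ≤ ∑ j, w j ^ 2 := by
  have h0 : 0 ≤ ∑ j, w j ^ 2 := Finset.sum_nonneg fun j _ => sq_nonneg _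
  rw [← Real.le_sqrt (norm_nonneg _) h0]
  refine T.opNorm_le_bound (Real.sqrt_nonneg _) fun x => ?_
  rw [← abs_of_nonneg (norm_nonneg (T x)), ← abs_of_nonneg (mul_nonneg (Real.sqrt_nonneg _)
    (norm_nonneg x)), ← sq_le_sq, mul_pow, Real.sq_sqrt h0,
    norm_sq_apply_of_orthonormalBasis b T w hT, Finset.sum_mul]
  refine Finset.sum_le_sum fun j _ => mul_le_mul_of_nonneg_left ?_ (sq_nonneg _)
  have := norm_inner_le_norm (𝕜 := ℂ) (b j) x
  rw [b.norm_eq_one, one_mul] at this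
  gcongr

/-- The square root of a positive semidefinite matrix, as an operator on `ℂ^N`. -/
noncomputable def sqrtCLM (B : Matrix (Fin N) (Fin N) ℂ) :
    EuclideanSpace ℂ (Fin N) →L[ℂ] EuclideanSpace ℂ (Fin N) :=
  Matrix.toEuclideanCLM (𝕜 := ℂ) (cfc Real.sqrt B)

theorem sqrtCLM_eigenvectorBasis {B : Matrix (Fin N) (Fin N) ℂ} (hB : B.IsHermitian) (j : Fin N) :
    sqrtCLM B (hB.eigenvectorBasis j) =
      ((Real.sqrt (hB.eigenvalues j) : ℝ) : ℂ) • hB.eigenvectorBasis j :=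
  toEuclideanCLM_cfc_eigenvectorBasis hB _ j

set_option synthInstance.maxHeartbeats 200000 in
theorem sqrtCLM_eq_sqrt {B : Matrix (Fin N) (Fin N) ℂ} (hB : B.PosSemidef) :
    0 ≤ Matrix.toEuclideanCLM (𝕜 := ℂ) B ∧
    sqrtCLM B = CFC.sqrt (Matrix.toEuclideanCLM (𝕜 := ℂ) B) := by
  set b := hB.1.eigenvectorBasis
  have hT : ∀ j, Matrix.toEuclideanCLM (𝕜 := ℂ) B (b j) = ((hB.1.eigenvalues j : ℝ) : ℂ) • b j := by
    intro j
    have := toEuclideanCLM_cfc_eigenvectorBasis hB.1 id j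
    rwa [cfc_id ℝ B hB.1.isSelfAdjoint] at this
  have hpos : ∀ (T : EuclideanSpace ℂ (Fin N) →L[ℂ] EuclideanSpace ℂ (Fin N)) (w : Fin N → ℝ),
      (∀ j, 0 ≤ w j) → (∀ j, T (b j) = ((w j : ℝ) : ℂ) • b j) → 0 ≤ T := by
    intro T w hw hTw
    rw [ContinuousLinearMap.nonneg_iff_isPositive]
    refine ⟨fun x y => inner_symm_of_orthonormalBasis b T w hTw x y, fun x => ?_⟩
    rw [ContinuousLinearMap.reApplyInnerSelf_apply, ← b.sum_inner_mul_inner, map_sum]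
    refine Finset.sum_nonneg fun j _ => ?_
    rw [inner_symm_of_orthonormalBasis b T w hTw, hTw, inner_smul_right, mul_assoc,
      ← inner_conj_symm (b j) x, Complex.mul_conj']
    have : (w j : ℂ) * (‖inner ℂ x (b j)‖ : ℂ) ^ 2 = ((w j * ‖inner ℂ x (b j)‖ ^ 2 : ℝ) : ℂ) := by
      push_cast; rfl
    rw [this]
    exact mul_nonneg (hw j) (sq_nonneg _)
  have h0 := hpos _ _ hB.eigenvalues_nonneg hT
  refine ⟨h0, ?_⟩
  symm
  rw [CFC.sqrt_eq_iff _ _ h0 (hpos _ _ (fun j => Real.sqrt_nonneg _) (sqrtCLM_eigenvectorBasis hB.1))]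
  refine ContinuousLinearMap.coe_injective (b.toBasis.ext fun j => ?_)
  rw [b.coe_toBasis]
  simp only [ContinuousLinearMap.coe_coe, mul_apply_eq_comp]
  rw [hT, sqrtCLM_eigenvectorBasis, map_smul, sqrtCLM_eigenvectorBasis, smul_smul]
  congr 1
  rw [← Complex.ofReal_mul, Real.mul_self_sqrt (hB.eigenvalues_nonneg j)]

theorem aestronglyMeasurable_sqrtCLM {α : Type*} [MeasurableSpace α] {μ : Measure α}
    {V : α → Matrix (Fin N) (Fin N) ℂ} (hV : ∀ x, (V x).PosSemidef)
    (hm : ∀ i j, AEStronglyMeasurable (fun x => V x i j) μ) :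
    AEStronglyMeasurable (fun x => sqrtCLM (V x)) μ := by
  have hVm : AEStronglyMeasurable V μ := by
    have : AEMeasurable (fun x => (fun i j => V x i j : Fin N → Fin N → ℂ)) μ :=
      aemeasurable_pi_lambda _ fun i => aemeasurable_pi_lambda _ fun j => (hm i j).aemeasurable
    exact this.aestronglyMeasurable
  have hc : Continuous fun B : Matrix (Fin N) (Fin N) ℂ => Matrix.toEuclideanCLM (𝕜 := ℂ) B :=
    LinearMap.continuous_of_finiteDimensional
      ((Matrix.toEuclideanCLM (𝕜 := ℂ) (n := Fin N)).toAlgEquiv.toLinearMap)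
  have h1 : AEStronglyMeasurable (fun x => Matrix.toEuclideanCLM (𝕜 := ℂ) (V x)) μ :=
    hc.comp_aestronglyMeasurable hVm
  let S : Set (EuclideanSpace ℂ (Fin N) →L[ℂ] EuclideanSpace ℂ (Fin N)) := {a | 0 ≤ a}
  have hS : IsClosed S := isClosed_Ici
  classical
  let _ : MeasurableSpace (EuclideanSpace ℂ (Fin N) →L[ℂ] EuclideanSpace ℂ (Fin N)) := borel _
  have : BorelSpace (EuclideanSpace ℂ (Fin N) →L[ℂ] EuclideanSpace ℂ (Fin N)) := ⟨rfl⟩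
  have h2 : Measurable (S.piecewise CFC.sqrt (fun _ => 0)) :=
    CFC.continuousOn_sqrt.measurable_piecewise continuousOn_const hS.measurableSet
  have : ProperSpace (EuclideanSpace ℂ (Fin N) →L[ℂ] EuclideanSpace ℂ (Fin N)) :=
    FiniteDimensional.proper ℂ _
  have h3 := (h2.comp_aemeasurable h1.aemeasurable).aestronglyMeasurable
  refine h3.congr (Filter.Eventually.of_forall fun x => ?_)
  have := sqrtCLM_eq_sqrt (hV x)
  simp only [Function.comp_apply]
  have hmem : Matrix.toEuclideanCLM (𝕜 := ℂ) (V x) ∈ S := this.1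
  rw [piecewise_eq_of_mem S _ _ hmem, this.2]

theorem norm_sqrtCLM_sq_le {B : Matrix (Fin N) (Fin N) ℂ} (hB : B.PosSemidef) :
    ‖sqrtCLM B‖ ^ 2 ≤ ∑ i, ‖B i i‖ := by
  refine (norm_sq_le_of_orthonormalBasis hB.1.eigenvectorBasis _ _
    (sqrtCLM_eigenvectorBasis hB.1)).trans ?_
  have h1 : ∑ j, Real.sqrt (hB.1.eigenvalues j) ^ 2 = B.trace.re := by
    rw [hB.1.trace_eq_sum_eigenvalues, Complex.re_sum]
    exact Finset.sum_congr rfl fun j _ => by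
      rw [Real.sq_sqrt (hB.eigenvalues_nonneg j)]; rfl
  rw [h1, Matrix.trace, Complex.re_sum]
  exact Finset.sum_le_sum fun i _ => Complex.re_le_norm _

theorem memLp_two_sqrtCLM {α : Type*} [MeasurableSpace α] {μ : Measure α}
    {V : α → Matrix (Fin N) (Fin N) ℂ} (hV : ∀ x, (V x).PosSemidef)
    (hint : ∀ i j, MemLp (fun x => V x i j) 1 μ) :
    MemLp (fun x => sqrtCLM (V x)) 2 μ := by
  have hm := aestronglyMeasurable_sqrtCLM hV fun i j => (hint i j).1
  refine (memLp_two_iff_integrable_sq_norm hm).2 ?_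
  have h1 : Integrable (fun x => ∑ i, ‖V x i i‖) μ :=
    integrable_finsetSum _ fun i _ => (memLp_one_iff_integrable.1 (hint i i)).norm
  refine h1.mono' (hm.norm.pow 2) (Filter.Eventually.of_forall fun x => ?_)
  rw [Real.norm_of_nonneg (sq_nonneg _)]
  exact norm_sqrtCLM_sq_le (hV x)

theorem exists_ae_norm_sqrtCLM_le {α : Type*} [MeasurableSpace α] {μ : Measure α}
    {V : α → Matrix (Fin N) (Fin N) ℂ} (hV : ∀ x, (V x).PosSemidef)
    (hb : ∀ i j, MemLp (fun x => V x i j) ⊤ μ) :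
    ∃ C : NNReal, ∀ᵐ x ∂μ, ‖sqrtCLM (V x)‖ ≤ C := by
  have h1 : ∀ i, ∀ᵐ x ∂μ, ‖V x i i‖ ≤ (eLpNorm (fun x => V x i i) ⊤ μ).toReal := by
    intro i
    filter_upwards [ae_le_eLpNormEssSup (f := fun x => V x i i) (μ := μ)] with x hx
    rw [← eLpNorm_exponent_top] at hx
    have := ENNReal.toReal_mono (hb i i).2.ne hx
    simpa using this
  refine ⟨⟨Real.sqrt (∑ i, (eLpNorm (fun x => V x i i) ⊤ μ).toReal), Real.sqrt_nonneg _⟩, ?_⟩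
  filter_upwards [ae_all_iff.2 h1] with x hx
  exact Real.le_sqrt_of_sq_le ((norm_sqrtCLM_sq_le (hV x)).trans
    (Finset.sum_le_sum fun i _ => hx i))

end MatrixPotential

section Resolvent

open scoped FourierTransform ENNReal NNReal

variable {d N : ℕ}

/-- The Fourier symbol `|2πp|² + t` of `-Δ + t`. -/
noncomputable def laplaceSymbol (t : ℝ) (p : Space d) : ℝ := (2 * Real.pi * ‖p‖) ^ 2 + t

theorem continuous_laplaceSymbol (t : ℝ) : Continuous (laplaceSymbol (d := d) t) := by
  unfold laplaceSymbol; fun_prop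

theorem le_laplaceSymbol (t : ℝ) (p : Space d) : t ≤ laplaceSymbol t p := by
  unfold laplaceSymbol; nlinarith [sq_nonneg (2 * Real.pi * ‖p‖)]

theorem laplaceSymbol_pos {t : ℝ} (ht : 0 < t) (p : Space d) : 0 < laplaceSymbol t p :=
  ht.trans_le (le_laplaceSymbol t p)

theorem measurable_inv_laplaceSymbol (t : ℝ) :
    Measurable fun p : Space d => (laplaceSymbol t p)⁻¹ :=
  (continuous_laplaceSymbol t).measurable.inv

theorem memLp_two_inv_laplaceSymbol (hd : d = 3) {t : ℝ} (ht : 0 < t) :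
    MemLp (fun p : Space d => (laplaceSymbol t p)⁻¹) 2 volume := by
  subst hd
  rw [memLp_two_iff_integrable_sq (measurable_inv_laplaceSymbol t).aestronglyMeasurable]
  have h := integrable_rpow_neg_one_add_norm_sq (E := Space 3) (μ := volume) (r := 4)
    (by rw [finrank_euclideanSpace_fin]; norm_num)
  set m := min 1 t with hm
  have hm0 : 0 < m := lt_min one_pos ht
  refine (h.const_mul ((m⁻¹) ^ 2)).mono'
    ((measurable_inv_laplaceSymbol t).pow_const 2).aestronglyMeasurable
    (Filter.Eventually.of_forall fun p => ?_)
  rw [Real.norm_of_nonneg (sq_nonneg _)]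
  have h1 : ((1 : ℝ) + ‖p‖ ^ 2) ^ (-(4 : ℝ) / 2) = ((1 + ‖p‖ ^ 2)⁻¹) ^ 2 := by
    rw [show (-(4 : ℝ) / 2) = -((2 : ℕ) : ℝ) by norm_num, Real.rpow_neg (by positivity),
      Real.rpow_natCast, inv_pow]
  rw [h1, ← mul_pow, ← mul_inv]
  have h2 : m * (1 + ‖p‖ ^ 2) ≤ laplaceSymbol t p := by
    unfold laplaceSymbol
    have h3 : m ≤ 1 := min_le_left _ _
    have h4 : m ≤ t := min_le_right _ _
    have h5 : ‖p‖ ^ 2 ≤ (2 * Real.pi * ‖p‖) ^ 2 := by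
      gcongr
      nlinarith [Real.pi_gt_three, norm_nonneg p]
    nlinarith [sq_nonneg ‖p‖]
  have h6 := inv_nonneg.2 (laplaceSymbol_pos ht p).le
  gcongr

/-- `R = (-Δ + t)⁻¹` on `L²(ℝ^d; ℂ^N)`. -/
def IsResolvent (t : ℝ) (R : L2 d N →L[ℂ] L2 d N) : Prop :=
  ∀ u : L2 d N, ∀ᵐ p, (𝓕 (R u) : L2 d N) p =
    (((laplaceSymbol t p)⁻¹ : ℝ) : ℂ) • (𝓕 u : L2 d N) p

theorem exists_isResolvent {t : ℝ} (ht : 0 < t) :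
    ∃ R : L2 d N →L[ℂ] L2 d N, IsResolvent t R := by
  let F := (Lp.fourierTransformₗᵢ (Space d) (EuclideanSpace ℂ (Fin N)))
  let FL : L2 d N →L[ℂ] L2 d N := F.toContinuousLinearEquiv
  have hm : Measurable fun p : Space d => (((laplaceSymbol t p)⁻¹ : ℝ) : ℂ) :=
    Complex.measurable_ofReal.comp (measurable_inv_laplaceSymbol t)
  obtain ⟨A, hA⟩ := exists_clm_apply_ae_eq FL
    (fun p => (((laplaceSymbol t p)⁻¹ : ℝ) : ℂ) • ContinuousLinearMap.id ℂ (EuclideanSpace ℂ (Fin N)))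
    (aestronglyMeasurable_smul_id hm.aestronglyMeasurable) (Real.toNNReal t⁻¹) (fun u => by
      have h1 : ‖u‖ₑ = ‖FL u‖ₑ := enorm_eq_iff_norm_eq.2 (F.norm_map u).symm
      rw [h1, Lp.enorm_def]
      refine eLpNorm_le_mul_eLpNorm_of_ae_le_mul' (p := 2) (c := Real.toNNReal t⁻¹)
        (Filter.Eventually.of_forall fun p => ?_) |>.trans (le_of_eq rfl)
      rw [smul_apply, ContinuousLinearMap.id_apply, enorm_smul]
      gcongr
      rw [← ofReal_norm, Complex.norm_real,
        Real.norm_of_nonneg (inv_nonneg.2 (laplaceSymbol_pos ht p).le)]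
      refine ENNReal.ofReal_le_ofReal ?_
      exact inv_anti₀ ht (le_laplaceSymbol t p))
  refine ⟨(F.symm.toContinuousLinearEquiv : L2 d N →L[ℂ] L2 d N) ∘L A, fun u => ?_⟩
  have h1 : (𝓕 (((F.symm.toContinuousLinearEquiv : L2 d N →L[ℂ] L2 d N) ∘L A) u) : L2 d N)
      = A u := F.apply_symm_apply (A u)
  rw [h1]
  filter_upwards [hA u] with p hp
  rw [hp]
  rfl

theorem integrable_inv_laplaceSymbol_mul {t : ℝ} (ht : 0 < t) (u w : L2 d N) :
    Integrable fun p => (((laplaceSymbol t p)⁻¹ : ℝ) : ℂ) * inner ℂ (u p) (w p) := by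
  refine (L2.integrable_inner (𝕜 := ℂ) u w).bdd_mul (c := t⁻¹)
    (Complex.measurable_ofReal.comp (measurable_inv_laplaceSymbol t)).aestronglyMeasurable
    (Filter.Eventually.of_forall fun p => ?_)
  rw [Complex.norm_real, Real.norm_of_nonneg (inv_nonneg.2 (laplaceSymbol_pos ht p).le)]
  exact inv_anti₀ ht (le_laplaceSymbol t p)

variable {t : ℝ} {R : L2 d N →L[ℂ] L2 d N}

theorem IsResolvent.inner_eq (hR : IsResolvent t R) (u w : L2 d N) :
    inner ℂ u (R w) = ∫ p, (((laplaceSymbol t p)⁻¹ : ℝ) : ℂ) *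
      inner ℂ ((𝓕 u : L2 d N) p) ((𝓕 w : L2 d N) p) := by
  rw [← Lp.inner_fourier_eq, L2.inner_def]
  refine integral_congr_ae ?_
  filter_upwards [hR w] with p hp
  rw [hp, inner_smul_right]

theorem IsResolvent.symm (hR : IsResolvent t R) (u w : L2 d N) :
    inner ℂ (R u) w = inner ℂ u (R w) := by
  rw [← inner_conj_symm, hR.inner_eq, hR.inner_eq, ← integral_conj]
  refine integral_congr_ae (Filter.Eventually.of_forall fun p => ?_)
  simp only [map_mul, Complex.conj_ofReal, inner_conj_symm]

theorem IsResolvent.re_inner_eq (hR : IsResolvent t R) (ht : 0 < t) (u : L2 d N) :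
    (inner ℂ u (R u)).re = ∫ p, (laplaceSymbol t p)⁻¹ * ‖(𝓕 u : L2 d N) p‖ ^ 2 := by
  rw [hR.inner_eq, ← Complex.reCLM_apply, ← ContinuousLinearMap.integral_comp_comm _
    (integrable_inv_laplaceSymbol_mul ht _ _)]
  refine integral_congr_ae (Filter.Eventually.of_forall fun p => ?_)
  simp only [Complex.reCLM_apply]
  rw [inner_self_eq_norm_sq_to_K, Complex.re_ofReal_mul]
  norm_cast

theorem integrable_laplaceSymbol_norm_sq {t : ℝ} (ht : 0 < t) (u : L2 d N) :
    Integrable fun p => (laplaceSymbol t p)⁻¹ * ‖u p‖ ^ 2 := by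
  refine ((memLp_two_iff_integrable_sq_norm (Lp.aestronglyMeasurable u)).1 (Lp.memLp u)).bdd_mul
    (c := t⁻¹) (measurable_inv_laplaceSymbol t).aestronglyMeasurable
    (Filter.Eventually.of_forall fun p => ?_)
  rw [Real.norm_of_nonneg (inv_nonneg.2 (laplaceSymbol_pos ht p).le)]
  exact inv_anti₀ ht (le_laplaceSymbol t p)

theorem norm_sq_Lp_two_eq_integral (u : L2 d N) : ‖u‖ ^ 2 = ∫ p, ‖u p‖ ^ 2 := by
  rw [← Complex.ofReal_inj, ← integral_complex_ofReal]
  have := inner_self_eq_norm_sq_to_K (𝕜 := ℂ) u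
  rw [L2.inner_def] at this
  push_cast
  rw [← Complex.coe_algebraMap, ← this]
  refine integral_congr_ae (Filter.Eventually.of_forall fun p => ?_)
  simp only
  rw [inner_self_eq_norm_sq_to_K]

theorem IsResolvent.norm_sq_eq (hR : IsResolvent t R) (u : L2 d N) :
    ‖R u‖ ^ 2 = ∫ p, (laplaceSymbol t p)⁻¹ ^ 2 * ‖(𝓕 u : L2 d N) p‖ ^ 2 := by
  rw [← Lp.norm_fourier_eq, norm_sq_Lp_two_eq_integral]
  refine integral_congr_ae ?_
  filter_upwards [hR u] with p hp
  rw [hp, norm_smul, mul_pow, Complex.norm_real, Real.norm_eq_abs, sq_abs]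

theorem integrable_laplaceSymbol_sq_norm_sq {t : ℝ} (ht : 0 < t) (u : L2 d N) :
    Integrable fun p => (laplaceSymbol t p)⁻¹ ^ 2 * ‖u p‖ ^ 2 := by
  refine ((memLp_two_iff_integrable_sq_norm (Lp.aestronglyMeasurable u)).1 (Lp.memLp u)).bdd_mul
    (c := t⁻¹ ^ 2) ((measurable_inv_laplaceSymbol t).pow_const 2).aestronglyMeasurable
    (Filter.Eventually.of_forall fun p => ?_)
  rw [Real.norm_of_nonneg (sq_nonneg _)]
  have := inv_nonneg.2 (laplaceSymbol_pos ht p).le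
  gcongr
  exact le_laplaceSymbol t p

/-- The first resolvent identity, as an inequality for quadratic forms. -/
theorem IsResolvent.re_inner_sub_le {s t : ℝ} (hs : 0 < s) (hst : s ≤ t)
    {R R' : L2 d N →L[ℂ] L2 d N} (hR : IsResolvent s R) (hR' : IsResolvent t R') (u : L2 d N) :
    (inner ℂ u (R u)).re - (inner ℂ u (R' u)).re ≤ (t - s) * ‖R u‖ ^ 2 := by
  have ht := hs.trans_le hst
  rw [hR.re_inner_eq hs, hR'.re_inner_eq ht, hR.norm_sq_eq, ← integral_sub
    (integrable_laplaceSymbol_norm_sq hs _) (integrable_laplaceSymbol_norm_sq ht _),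
    ← integral_const_mul]
  refine integral_mono ((integrable_laplaceSymbol_norm_sq hs _).sub
    (integrable_laplaceSymbol_norm_sq ht _)) ((integrable_laplaceSymbol_sq_norm_sq hs _).const_mul _)
    fun p => ?_
  simp only
  rw [← sub_mul, ← mul_assoc]
  refine mul_le_mul_of_nonneg_right ?_ (sq_nonneg _)
  have h1 := laplaceSymbol_pos hs p
  have h2 : laplaceSymbol t p = laplaceSymbol s p + (t - s) := by unfold laplaceSymbol; ring
  have h3 : 0 ≤ t - s := by linarith
  rw [h2]
  set h := laplaceSymbol s p
  have h4 : h⁻¹ - (h + (t - s))⁻¹ = (t - s) * (h⁻¹ * (h + (t - s))⁻¹) := by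
    field_simp; ring
  rw [h4, sq]
  gcongr
  linarith

end Resolvent

section SandwichedResolvent

open scoped FourierTransform ENNReal NNReal

variable {d N : ℕ}

theorem inner_mul_symm {W : Space d → EuclideanSpace ℂ (Fin N) →L[ℂ] EuclideanSpace ℂ (Fin N)}
    (hsymm : ∀ x a b, inner ℂ (W x a) b = inner ℂ a (W x b))
    {M : L2 d N →L[ℂ] L2 d N} (hM : ∀ u, ∀ᵐ x, M u x = W x (u x)) (u w : L2 d N) :
    inner ℂ (M u) w = inner ℂ u (M w) := by
  rw [L2.inner_def, L2.inner_def]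
  refine integral_congr_ae ?_
  filter_upwards [hM u, hM w] with x h1 h2
  rw [h1, h2, hsymm]

theorem isPositive_sandwich {t : ℝ} (ht : 0 < t) {M R : L2 d N →L[ℂ] L2 d N}
    (hMs : ∀ u w, inner ℂ (M u) w = inner ℂ u (M w)) (hR : IsResolvent t R) :
    (M ∘L R ∘L M).IsPositive := by
  refine ⟨fun u w => ?_, fun u => ?_⟩
  · simp only [ContinuousLinearMap.coe_coe, ContinuousLinearMap.comp_apply]
    rw [hMs, hR.symm, hMs]
  · rw [ContinuousLinearMap.reApplyInnerSelf_apply]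
    simp only [ContinuousLinearMap.comp_apply]
    rw [hMs, hR.symm]
    change 0 ≤ (inner ℂ (M u) (R (M u))).re
    rw [hR.re_inner_eq ht]
    exact integral_nonneg fun p => mul_nonneg (inv_nonneg.2 (laplaceSymbol_pos ht p).le)
      (sq_nonneg _)

theorem sum_norm_resolvent_sq_le (hd : d = 3) {t : ℝ} (ht : 0 < t) {M R : L2 d N →L[ℂ] L2 d N}
    (hR : IsResolvent t R) {C : ℝ}
    (hC : ∀ (ι : Type) [Fintype ι] (e : ι → L2 d N), Orthonormal ℂ e →
      ∀ᵐ p, ∑ k, ‖(𝓕 (M (e k)) : L2 d N) p‖ ^ 2 ≤ C)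
    {ι : Type} [Fintype ι] (e : ι → L2 d N) (he : Orthonormal ℂ e) :
    ∑ k, ‖R (M (e k))‖ ^ 2 ≤ C * ∫ p : Space d, (laplaceSymbol t p)⁻¹ ^ 2 := by
  simp only [hR.norm_sq_eq]
  rw [← integral_finsetSum _ fun k _ => integrable_laplaceSymbol_sq_norm_sq ht _,
    ← integral_const_mul]
  refine integral_mono_ae (integrable_finsetSum _ fun k _ =>
    integrable_laplaceSymbol_sq_norm_sq ht _)
    (((memLp_two_iff_integrable_sq (measurable_inv_laplaceSymbol t).aestronglyMeasurable).1
      (memLp_two_inv_laplaceSymbol hd ht)).const_mul _) ?_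
  filter_upwards [hC ι e he] with p hp
  rw [← Finset.mul_sum, mul_comm]
  exact mul_le_mul_of_nonneg_right hp (sq_nonneg _)

theorem isCompactOperator_sandwich (hd : d = 3) {t : ℝ} (ht : 0 < t) {M R : L2 d N →L[ℂ] L2 d N}
    (hR : IsResolvent t R) {C : ℝ}
    (hC : ∀ (ι : Type) [Fintype ι] (e : ι → L2 d N), Orthonormal ℂ e →
      ∀ᵐ p, ∑ k, ‖(𝓕 (M (e k)) : L2 d N) p‖ ^ 2 ≤ C) :
    IsCompactOperator (M ∘L R ∘L M) :=
  (isCompactOperator_of_sum_norm_sq_le (R ∘L M) _ fun _ _ e he =>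
    sum_norm_resolvent_sq_le hd ht hR hC e he).clm_comp M

theorem tendsto_integral_inv_laplaceSymbol_sq (hd : d = 3) :
    Filter.Tendsto (fun t : ℝ => ∫ p : Space d, (laplaceSymbol t p)⁻¹ ^ 2) Filter.atTop
      (nhds 0) := by
  have h : Filter.Tendsto (fun t : ℝ => ∫ p : Space d, (laplaceSymbol t p)⁻¹ ^ 2) Filter.atTop
      (nhds (∫ _ : Space d, (0 : ℝ))) := by
    refine tendsto_integral_filter_of_dominated_convergence
      (fun p => (laplaceSymbol 1 p)⁻¹ ^ 2) (Filter.Eventually.of_forall fun t =>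
        ((measurable_inv_laplaceSymbol t).pow_const 2).aestronglyMeasurable) ?_
      ((memLp_two_iff_integrable_sq (measurable_inv_laplaceSymbol 1).aestronglyMeasurable).1
      (memLp_two_inv_laplaceSymbol hd one_pos)) (Filter.Eventually.of_forall fun p => ?_)
    · filter_upwards [Filter.eventually_ge_atTop 1] with t ht
      refine Filter.Eventually.of_forall fun p => ?_
      rw [Real.norm_of_nonneg (sq_nonneg _)]
      have h1 := laplaceSymbol_pos (one_pos.trans_le ht) p
      have h2 := laplaceSymbol_pos one_pos p
      have h3 : laplaceSymbol 1 p ≤ laplaceSymbol t p := by unfold laplaceSymbol; linarith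
      have h4 := inv_nonneg.2 h1.le
      gcongr
    · have h1 : Filter.Tendsto (fun t : ℝ => laplaceSymbol t p) Filter.atTop Filter.atTop :=
        Filter.tendsto_atTop_mono (fun t => le_laplaceSymbol t p) Filter.tendsto_id
      have := (h1.inv_tendsto_atTop).pow 2
      simpa using this
  simpa using h

/-! ### The convex function `x ↦ x - log (1 + x)` -/

/-- The function `x ↦ x - log (1 + x)`. -/
noncomputable def subLog (x : ℝ) : ℝ := x - Real.log (1 + x)

theorem subLog_zero : subLog 0 = 0 := by simp [subLog]

theorem subLog_tangent {a b : ℝ} (ha : 0 ≤ a) (hb : 0 ≤ b) :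
    subLog a + a / (1 + a) * (b - a) ≤ subLog b := by
  unfold subLog
  have h1 : Real.log ((1 + b) / (1 + a)) ≤ (1 + b) / (1 + a) - 1 :=
    Real.log_le_sub_one_of_pos (by positivity)
  rw [Real.log_div (by positivity) (by positivity)] at h1
  have h2 : (1 + b) / (1 + a) - 1 = (b - a) - a / (1 + a) * (b - a) := by
    field_simp; ring
  linarith

theorem subLog_nonneg {a : ℝ} (ha : 0 ≤ a) : 0 ≤ subLog a := by
  have := subLog_tangent le_rfl ha
  simpa [subLog_zero] using this

theorem subLog_le_sq {a : ℝ} (ha : 0 ≤ a) : subLog a ≤ a ^ 2 := by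
  have h1 := subLog_tangent ha le_rfl
  rw [subLog_zero] at h1
  have h2 : a / (1 + a) * a ≤ a ^ 2 := by
    rw [sq]
    exact mul_le_mul_of_nonneg_right (div_le_self ha (by linarith)) ha
  linarith

/-- The trace of `φ (K)`, `φ x = x - log (1 + x)`, for a positive operator `K`, as a supremum. -/
noncomputable def supSubLog {H : Type} [NormedAddCommGroup H] [InnerProductSpace ℂ H]
    (K : H →L[ℂ] H) : ℝ≥0∞ :=
  ⨆ (ι : {s : Finset H // Orthonormal ℂ ((↑) : s → H)}),
    ENNReal.ofReal (∑ x ∈ ι.1, subLog (inner ℂ x (K x)).re)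

theorem ofReal_sum_subLog_le_supSubLog {H : Type} [NormedAddCommGroup H] [InnerProductSpace ℂ H]
    (K : H →L[ℂ] H) {ι : Type} [Fintype ι] (e : ι → H) (he : Orthonormal ℂ e) :
    ENNReal.ofReal (∑ i, subLog (inner ℂ (e i) (K (e i))).re) ≤ supSubLog K := by
  classical
  have hinj := he.linearIndependent.injective
  have h1 : Orthonormal ℂ ((↑) : ↥(Finset.univ.image e) → H) := by
    have := he.toSubtypeRange
    rw [← image_univ, ← Finset.coe_univ, ← Finset.coe_image] at this
    exact this
  refine le_trans (le_of_eq ?_) (le_iSup (fun ι : {s : Finset H // Orthonormal ℂ ((↑) : s → H)} =>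
    ENNReal.ofReal (∑ x ∈ ι.1, subLog (inner ℂ x (K x)).re)) ⟨Finset.univ.image e, h1⟩)
  rw [Finset.sum_image fun a _ b _ h => hinj h]

theorem supSubLog_le {H : Type} [NormedAddCommGroup H] [InnerProductSpace ℂ H]
    (K : H →L[ℂ] H) (C : ℝ≥0∞) (hC : ∀ (ι : Type) [Fintype ι] (e : ι → H), Orthonormal ℂ e →
      ENNReal.ofReal (∑ i, subLog (inner ℂ (e i) (K (e i))).re) ≤ C) : supSubLog K ≤ C := by
  refine iSup_le fun s => ?_
  have := hC s.1 (fun x => x) s.2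
  rwa [Finset.sum_coe_sort s.1 (fun x => subLog (inner ℂ x (K x)).re)] at this

/-- For a compact operator, only eigenvectors need to be considered in `supSubLog`. -/
theorem supSubLog_le_of_eigenvectors {H : Type} [NormedAddCommGroup H] [InnerProductSpace ℂ H]
    [CompleteSpace H] (K : H →L[ℂ] H) (hc : IsCompactOperator K) (hK : K.IsPositive) (C : ℝ≥0∞)
    (hC : ∀ (ι : Type) [Fintype ι] (e : ι → H) (μ : ι → ℝ), Orthonormal ℂ e → (∀ i, 0 ≤ μ i) →
      (∀ i, K (e i) = ((μ i : ℝ) : ℂ) • e i) → ENNReal.ofReal (∑ i, subLog (μ i)) ≤ C) :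
    supSubLog K ≤ C := by
  rcases eq_or_ne C ∞ with rfl | hCtop
  · exact le_top
  refine supSubLog_le K C fun ι _ e he => ?_
  rw [ENNReal.ofReal_le_iff_le_toReal hCtop]
  refine sum_convex_inner_le_of_eigenvectors K hc hK subLog (fun a => a / (1 + a))
    (fun a => subLog_nonneg) (fun a b => subLog_tangent) C.toReal ?_ e he
  intro κ _ f μ hf hμ
  rw [← ENNReal.ofReal_le_iff_le_toReal hCtop]
  refine hC κ f μ hf (fun i => ?_) hμ
  have := hK.re_inner_nonneg_right (f i)
  rw [hμ, inner_smul_right, inner_self_eq_norm_sq_to_K, hf.1 i] at this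
  simpa using this

theorem supSubLog_sandwich_le (hd : d = 3) {t : ℝ} (ht : 0 < t) {M R : L2 d N →L[ℂ] L2 d N}
    (hMs : ∀ u w, inner ℂ (M u) w = inner ℂ u (M w)) (hR : IsResolvent t R) {C : ℝ}
    (hC : ∀ (ι : Type) [Fintype ι] (e : ι → L2 d N), Orthonormal ℂ e →
      ∀ᵐ p, ∑ k, ‖(𝓕 (M (e k)) : L2 d N) p‖ ^ 2 ≤ C) :
    supSubLog (M ∘L R ∘L M) ≤
      ENNReal.ofReal (‖M‖ ^ 2 * (C * ∫ p : Space d, (laplaceSymbol t p)⁻¹ ^ 2)) := by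
  refine supSubLog_le _ _ fun ι _ e he => ENNReal.ofReal_le_ofReal ?_
  refine le_trans ?_ (mul_le_mul_of_nonneg_left (sum_norm_resolvent_sq_le hd ht hR hC e he)
    (sq_nonneg _))
  rw [Finset.mul_sum]
  refine Finset.sum_le_sum fun i _ => ?_
  have h0 := (isPositive_sandwich ht hMs hR).re_inner_nonneg_right (e i)
  refine (subLog_le_sq h0).trans ?_
  rw [← mul_pow]
  refine pow_le_pow_left₀ h0 ?_ 2
  refine (Complex.re_le_norm _).trans ((norm_inner_le_norm _ _).trans ?_)
  rw [he.1 i, one_mul]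
  exact M.le_opNorm _

end SandwichedResolvent

section ResolventTraceInequality

open scoped FourierTransform ENNReal NNReal

variable {d N : ℕ}

theorem ofReal_integral_le_lintegral_ofReal {α : Type*} [MeasurableSpace α] {μ : Measure α}
    {f : α → ℝ} (hf : Integrable f μ) :
    ENNReal.ofReal (∫ x, f x ∂μ) ≤ ∫⁻ x, ENNReal.ofReal (f x) ∂μ := by
  have h1 : ∫ x, f x ∂μ ≤ ∫ x, max (f x) 0 ∂μ :=
    integral_mono hf hf.pos_part fun x => le_max_left _ _
  refine (ENNReal.ofReal_le_ofReal h1).trans (le_of_eq ?_)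
  rw [ofReal_integral_eq_lintegral_ofReal hf.pos_part
    (Filter.Eventually.of_forall fun x => le_max_right _ _)]
  simp [ENNReal.ofReal_max]

theorem integrable_inv_laplaceSymbol_smul (hd : d = 3) {t : ℝ} (ht : 0 < t) (u : L2 d N) :
    Integrable fun p => (((laplaceSymbol t p)⁻¹ : ℝ) : ℂ) • u p := by
  have h := MemLp.integrable_mul (p := 2) (q := 2) (memLp_two_inv_laplaceSymbol (d := d) hd ht)
    (Lp.memLp u).norm
  refine h.mono' ((Complex.measurable_ofReal.comp
    (measurable_inv_laplaceSymbol t)).aestronglyMeasurable.smul (Lp.aestronglyMeasurable u))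
    (Filter.Eventually.of_forall fun p => ?_)
  rw [norm_smul, Complex.norm_real,
    Real.norm_of_nonneg (inv_nonneg.2 (laplaceSymbol_pos ht p).le)]
  rfl

/-- The value at `x` of the continuous representative of `(-Δ + t)⁻¹ u`. -/
noncomputable def resolventEval (t : ℝ) (x : Space d) (u : L2 d N) : EuclideanSpace ℂ (Fin N) :=
  ∫ p, Real.fourierChar (inner ℝ p x) • ((((laplaceSymbol t p)⁻¹ : ℝ) : ℂ) • (𝓕 u : L2 d N) p)

theorem integrable_resolventEval (hd : d = 3) {t : ℝ} (ht : 0 < t) (x : Space d) (u : L2 d N) :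
    Integrable fun p => Real.fourierChar (inner ℝ p x) •
      ((((laplaceSymbol t p)⁻¹ : ℝ) : ℂ) • (𝓕 u : L2 d N) p) := by
  have h := (Real.fourierIntegral_convergent_iff (-x)).2
    (integrable_inv_laplaceSymbol_smul hd ht (𝓕 u : L2 d N))
  simpa using h

theorem IsResolvent.ae_eq_resolventEval (hd : d = 3) {t : ℝ} (ht : 0 < t)
    {R : L2 d N →L[ℂ] L2 d N} (hR : IsResolvent t R) (u : L2 d N) :
    ∀ᵐ x, R u x = resolventEval t x u := by
  have hint : Integrable ((𝓕 (R u) : L2 d N) : Space d → EuclideanSpace ℂ (Fin N)) :=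
    (integrable_inv_laplaceSymbol_smul hd ht (𝓕 u : L2 d N)).congr
      ((hR u).mono fun p hp => hp.symm)
  have h1 := fourierInv_Lp_two_ae_eq (𝓕 (R u) : L2 d N) hint
  have h2 : (𝓕⁻ (𝓕 (R u) : L2 d N) : L2 d N) = R u := FourierTransform.fourierInv_fourier_eq _
  rw [h2] at h1
  filter_upwards [h1] with x hx
  rw [hx, Real.fourierInv_eq, resolventEval]
  refine integral_congr_ae ?_
  filter_upwards [hR u] with p hp
  rw [hp]

theorem fourier_sum_smul {ι : Type*} (s : Finset ι) (α : ι → ℂ) (u : ι → L2 d N) :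
    ∀ᵐ p, (𝓕 (∑ k ∈ s, α k • u k) : L2 d N) p = ∑ k ∈ s, α k • (𝓕 (u k) : L2 d N) p := by
  let F := (Lp.fourierTransformₗᵢ (Space d) (EuclideanSpace ℂ (Fin N)))
  have h1 : (𝓕 (∑ k ∈ s, α k • u k) : L2 d N) = ∑ k ∈ s, α k • (𝓕 (u k) : L2 d N) := by
    have : F (∑ k ∈ s, α k • u k) = ∑ k ∈ s, α k • F (u k) := by
      simp
    exact this
  rw [h1]
  have h2 := Lp.coeFn_finsetSum s (fun k => α k • (𝓕 (u k) : L2 d N))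
  have h3 := (ae_ball_iff s.countable_toSet).2 fun k _ => Lp.coeFn_smul (α k) (𝓕 (u k) : L2 d N)
  filter_upwards [h2, h3] with p hp2 hp3
  rw [hp2, Finset.sum_apply]
  exact Finset.sum_congr rfl fun k hk => hp3 k hk

theorem resolventEval_sum_smul (hd : d = 3) {t : ℝ} (ht : 0 < t) (x : Space d)
    {ι : Type*} (s : Finset ι) (α : ι → ℂ) (u : ι → L2 d N) :
    resolventEval t x (∑ k ∈ s, α k • u k) = ∑ k ∈ s, α k • resolventEval t x (u k) := by
  unfold resolventEval
  simp only [← integral_smul]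
  refine Eq.trans ?_ (integral_finsetSum s
    fun k _ => (integrable_resolventEval hd ht x (u k)).smul (α k))
  refine integral_congr_ae ?_
  filter_upwards [fourier_sum_smul s α u] with p hp
  rw [hp, Finset.smul_sum, Finset.smul_sum]
  refine Finset.sum_congr rfl fun k _ => ?_
  rw [smul_comm _ (α k), smul_comm _ (α k)]

/-- The variational lower bound for `∫ v² / (h² (h + v))`. -/
theorem ofReal_variational_le (hd : d = 3) {t : ℝ} (ht : 0 < t)
    {R : L2 d N →L[ℂ] L2 d N} (hR : IsResolvent t R) (x : Space d) {v : ℝ} (hv : 0 ≤ v)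
    {b : EuclideanSpace ℂ (Fin N)} (hb : ‖b‖ = 1) (ω : L2 d N) :
    ENNReal.ofReal (2 * v * (inner ℂ (resolventEval t x (R ω)) b).re - (inner ℂ ω (R ω)).re
      - v * ‖R ω‖ ^ 2) ≤
    ∫⁻ p : Space d, ENNReal.ofReal
      (v ^ 2 / (laplaceSymbol t p ^ 2 * (laplaceSymbol t p + v))) := by
  have hint := integrable_resolventEval hd ht x (R ω)
  set y : Space d → EuclideanSpace ℂ (Fin N) := fun p => Real.fourierChar (inner ℝ p x) •
      ((((laplaceSymbol t p)⁻¹ : ℝ) : ℂ) • (𝓕 (R ω) : L2 d N) p) with hy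
  have h1 : (inner ℂ (resolventEval t x (R ω)) b).re = ∫ p, (inner ℂ (y p) b).re := by
    have e1 : inner ℂ (resolventEval t x (R ω)) b = ∫ p, inner ℂ (y p) b := by
      rw [← inner_conj_symm, resolventEval, ← integral_inner hint, ← integral_conj]
      simp only [inner_conj_symm]
    rw [e1, ← Complex.reCLM_apply, ← ContinuousLinearMap.integral_comp_comm _
      (hint.inner_const b)]
    rfl
  have i1 : Integrable fun p => (inner ℂ (y p) b).re := (hint.inner_const (𝕜 := ℂ) b).re
  have i2 := integrable_laplaceSymbol_norm_sq ht (𝓕 ω : L2 d N)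
  have i3 := integrable_laplaceSymbol_sq_norm_sq ht (𝓕 ω : L2 d N)
  have i12 : Integrable fun p => 2 * v * (inner ℂ (y p) b).re
      - (laplaceSymbol t p)⁻¹ * ‖(𝓕 ω : L2 d N) p‖ ^ 2 := (i1.const_mul _).sub i2
  rw [h1, hR.re_inner_eq ht, hR.norm_sq_eq, ← integral_const_mul, ← integral_const_mul,
    ← integral_sub (i1.const_mul _) i2, ← integral_sub i12 (i3.const_mul _)]
  refine (ofReal_integral_le_lintegral_ofReal (i12.sub (i3.const_mul _))).trans ?_
  refine lintegral_mono_ae ?_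
  filter_upwards [hR ω] with p hp
  refine ENNReal.ofReal_le_ofReal ?_
  have hh := laplaceSymbol_pos ht p
  set h := laplaceSymbol t p
  set r := ‖(𝓕 ω : L2 d N) p‖
  have hr : 0 ≤ r := norm_nonneg _
  have h2 : (inner ℂ (y p) b).re ≤ h⁻¹ * (h⁻¹ * r) := by
    refine (Complex.re_le_norm _).trans ((norm_inner_le_norm _ _).trans (le_of_eq ?_))
    have h3 : ‖y p‖ = ‖(((h⁻¹ : ℝ)) : ℂ) • (𝓕 (R ω) : L2 d N) p‖ := by
      change ‖(Real.fourierChar (inner ℝ p x) : ℂ) •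
        ((((laplaceSymbol t p)⁻¹ : ℝ) : ℂ) • (𝓕 (R ω) : L2 d N) p)‖ = _
      rw [norm_smul, Circle.norm_coe, one_mul]
    rw [hb, mul_one, h3, hp, norm_smul, norm_smul, Complex.norm_real,
      Real.norm_of_nonneg (inv_nonneg.2 hh.le)]
  have h4 : 2 * v * (inner ℂ (y p) b).re ≤ 2 * v * (h⁻¹ * (h⁻¹ * r)) := by gcongr
  have h5 : v ^ 2 / (h ^ 2 * (h + v)) - (2 * v * (h⁻¹ * (h⁻¹ * r)) - h⁻¹ * r ^ 2
      - v * (h⁻¹ ^ 2 * r ^ 2)) = (v - (h + v) * r) ^ 2 / (h ^ 2 * (h + v)) := by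
    field_simp
    ring
  have h6 : 0 ≤ (v - (h + v) * r) ^ 2 / (h ^ 2 * (h + v)) := by positivity
  change 2 * v * (inner ℂ (y p) b).re - h⁻¹ * r ^ 2 - v * (h⁻¹ ^ 2 * r ^ 2) ≤ _
  linarith

end ResolventTraceInequality

section ResolventTraceInequality

open scoped FourierTransform ENNReal NNReal

theorem ofReal_finsetSum_le {ι : Type*} (s : Finset ι) (f : ι → ℝ) :
    ENNReal.ofReal (∑ i ∈ s, f i) ≤ ∑ i ∈ s, ENNReal.ofReal (f i) := by
  classical
  induction s using Finset.induction_on with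
  | empty => simp
  | insert a s ha ih =>
    rw [Finset.sum_insert ha, Finset.sum_insert ha]
    exact ENNReal.ofReal_add_le.trans (add_le_add le_rfl ih)

section Algebra

variable {E : Type*} [NormedAddCommGroup E] [InnerProductSpace ℂ E] {κ ι : Type*} [Fintype κ]
  [Fintype ι] (b : OrthonormalBasis κ ℂ E) (W : E →L[ℂ] E) (v : κ → ℝ)

theorem sqrt_mul_inner_eq (hW : ∀ j, W (b j) = ((Real.sqrt (v j) : ℝ) : ℂ) • b j)
    {η ψ : E} {μ : ℝ} (h : W η = ((μ : ℝ) : ℂ) • ψ) (j : κ) :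
    ((Real.sqrt (v j) : ℝ) : ℂ) * inner ℂ (b j) η = (μ : ℂ) * inner ℂ (b j) ψ := by
  have h1 := inner_symm_of_orthonormalBasis b W _ hW (b j) η
  rwa [hW, h, inner_smul_left, inner_smul_right, Complex.conj_ofReal] at h1

theorem sum_mul_inner_mul_inner (hv : ∀ j, 0 ≤ v j)
    (hW : ∀ j, W (b j) = ((Real.sqrt (v j) : ℝ) : ℂ) • b j)
    {η ψ ρ : E} {μ : ℝ} (h : W η = ((μ : ℝ) : ℂ) • ψ) :
    ∑ j, (v j : ℂ) * (inner ℂ (b j) η * inner ℂ ρ (b j)) = (μ : ℂ) * inner ℂ ρ (W ψ) := by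
  rw [← b.sum_inner_mul_inner ρ, Finset.mul_sum]
  refine Finset.sum_congr rfl fun j _ => ?_
  have h1 := sqrt_mul_inner_eq b W v hW h j
  have h2 := inner_symm_of_orthonormalBasis b W _ hW (b j) ψ
  rw [hW, inner_smul_left, Complex.conj_ofReal] at h2
  have h3 : (v j : ℂ) = ((Real.sqrt (v j) : ℝ) : ℂ) * ((Real.sqrt (v j) : ℝ) : ℂ) := by
    rw [← Complex.ofReal_mul, Real.mul_self_sqrt (hv j)]
  rw [← h2, h3]
  linear_combination (((Real.sqrt (v j) : ℝ) : ℂ) * inner ℂ ρ (b j)) * h1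

theorem sum_mul_inner_mul_inner' (hv : ∀ j, 0 ≤ v j)
    (hW : ∀ j, W (b j) = ((Real.sqrt (v j) : ℝ) : ℂ) • b j)
    {η ψ η' ψ' : E} {μ μ' : ℝ} (h : W η = ((μ : ℝ) : ℂ) • ψ) (h' : W η' = ((μ' : ℝ) : ℂ) • ψ') :
    ∑ j, (v j : ℂ) * (inner ℂ (b j) η * inner ℂ η' (b j)) =
      ((μ : ℂ) * (μ' : ℂ)) * inner ℂ ψ' ψ := by
  rw [sum_mul_inner_mul_inner b W v hv hW h, ← inner_symm_of_orthonormalBasis b W _ hW, h',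
    inner_smul_left, Complex.conj_ofReal]
  ring

end Algebra

variable {d N : ℕ}

theorem inner_sum_smul_sum_smul {H : Type*} [NormedAddCommGroup H] [InnerProductSpace ℂ H]
    {ι : Type*} [Fintype ι] (α : ι → ℂ) (u w : ι → H) :
    inner ℂ (∑ k, α k • u k) (∑ l, α l • w l) =
      ∑ k, ∑ l, (starRingEnd ℂ (α k) * α l) * inner ℂ (u k) (w l) := by
  rw [sum_inner]
  refine Finset.sum_congr rfl fun k _ => ?_
  rw [inner_sum]
  refine Finset.sum_congr rfl fun l _ => ?_
  rw [inner_smul_left, inner_smul_right]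
  ring

/-- The trace inequality `Tr R₀ V R V R₀ ≤ ∬ tr V² / (h² (h + V))` for the resolvents
`R₀ = (-Δ + t)⁻¹` and `R = (-Δ + V + t)⁻¹`, expressed through eigenvectors of the operator
`V^{1/2} R₀ V^{1/2}`. -/
theorem ofReal_sum_resolvent_le (hd : d = 3) {t : ℝ} (ht : 0 < t)
    {W : Space d → EuclideanSpace ℂ (Fin N) →L[ℂ] EuclideanSpace ℂ (Fin N)}
    (b : Space d → OrthonormalBasis (Fin N) ℂ (EuclideanSpace ℂ (Fin N)))
    (v : Space d → Fin N → ℝ) (hv : ∀ x j, 0 ≤ v x j)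
    (hWb : ∀ x j, W x (b x j) = ((Real.sqrt (v x j) : ℝ) : ℂ) • b x j)
    {M R : L2 d N →L[ℂ] L2 d N} (hM : ∀ u, ∀ᵐ x, M u x = W x (u x)) (hR : IsResolvent t R)
    {ι : Type} [Fintype ι] (ψ : ι → L2 d N) (hψ : Orthonormal ℂ ψ) (μ : ι → ℝ)
    (hμ : ∀ k, 0 ≤ μ k) (heig : ∀ k, M (R (M (ψ k))) = ((μ k : ℝ) : ℂ) • ψ k) :
    ENNReal.ofReal (∑ k, μ k / (1 + μ k) * ‖R (M (ψ k))‖ ^ 2) ≤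
      ∫⁻ x, ∑ j, ∫⁻ p : Space d, ENNReal.ofReal
        (v x j ^ 2 / (laplaceSymbol t p ^ 2 * (laplaceSymbol t p + v x j))) := by
  classical
  have hsymm : ∀ x a a', inner ℂ (W x a) a' = inner ℂ a (W x a') := fun x =>
    inner_symm_of_orthonormalBasis (b x) (W x) _ (hWb x)
  have hMs := inner_mul_symm hsymm hM
  set w : ι → L2 d N := fun k => M (ψ k) with hw
  set η : ι → L2 d N := fun k => R (w k) with hη
  let c : ι → ℝ := fun k => (1 + μ k)⁻¹
  have hwη : ∀ k l, inner ℂ (w k) (η l) = if k = l then ((μ l : ℝ) : ℂ) else 0 := by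
    intro k l
    rw [hw, hη, hMs, heig, inner_smul_right, orthonormal_iff_ite.1 hψ k l]
    simp
  let Gc : Space d → ℂ := fun x =>
    (∑ k, ((2 * c k * μ k : ℝ) : ℂ) * inner ℂ (R (η k) x) (w k x))
    - (∑ k, ((c k ^ 2 * μ k : ℝ) : ℂ) * inner ℂ (η k x) (η k x))
    - ∑ k, ∑ l, (((c k * c l * μ k * μ l : ℝ) : ℂ) * inner ℂ (η k) (η l)) *
        inner ℂ (ψ l x) (ψ k x)
  have i1 : ∀ k, Integrable fun x => ((2 * c k * μ k : ℝ) : ℂ) * inner ℂ (R (η k) x) (w k x) :=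
    fun k => (L2.integrable_inner (𝕜 := ℂ) (R (η k)) (w k)).const_mul _
  have i2 : ∀ k, Integrable fun x => ((c k ^ 2 * μ k : ℝ) : ℂ) * inner ℂ (η k x) (η k x) :=
    fun k => (L2.integrable_inner (𝕜 := ℂ) (η k) (η k)).const_mul _
  have i3 : ∀ k l, Integrable fun x => (((c k * c l * μ k * μ l : ℝ) : ℂ) *
      inner ℂ (η k) (η l)) * inner ℂ (ψ l x) (ψ k x) :=
    fun k l => (L2.integrable_inner (𝕜 := ℂ) (ψ l) (ψ k)).const_mul _
  have j1 := integrable_finsetSum Finset.univ fun k _ => i1 k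
  have j2 := integrable_finsetSum Finset.univ fun k _ => i2 k
  have j3 := integrable_finsetSum Finset.univ fun k _ =>
    integrable_finsetSum Finset.univ fun l _ => i3 k l
  have hGi : Integrable Gc := (j1.sub j2).sub j3
  have hGint : (∫ x, Gc x).re = ∑ k, μ k / (1 + μ k) * ‖η k‖ ^ 2 := by
    have e1 : ∫ x, Gc x = (∑ k, ((2 * c k * μ k : ℝ) : ℂ) * inner ℂ (R (η k)) (w k))
        - (∑ k, ((c k ^ 2 * μ k : ℝ) : ℂ) * inner ℂ (η k) (η k))
        - ∑ k, ∑ l, (((c k * c l * μ k * μ l : ℝ) : ℂ) * inner ℂ (η k) (η l)) *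
          inner ℂ (ψ l) (ψ k) := by
      change ∫ x, ((∑ k, ((2 * c k * μ k : ℝ) : ℂ) * inner ℂ (R (η k) x) (w k x))
        - (∑ k, ((c k ^ 2 * μ k : ℝ) : ℂ) * inner ℂ (η k x) (η k x))
        - ∑ k, ∑ l, (((c k * c l * μ k * μ l : ℝ) : ℂ) * inner ℂ (η k) (η l)) *
        inner ℂ (ψ l x) (ψ k x)) = _
      have j12 : Integrable fun x =>
          (∑ k, ((2 * c k * μ k : ℝ) : ℂ) * inner ℂ (R (η k) x) (w k x))
          - (∑ k, ((c k ^ 2 * μ k : ℝ) : ℂ) * inner ℂ (η k x) (η k x)) := j1.sub j2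
      rw [integral_sub j12 j3, integral_sub j1 j2,
        integral_finsetSum _ fun k _ => i1 k, integral_finsetSum _ fun k _ => i2 k,
        integral_finsetSum _ fun k _ => integrable_finsetSum Finset.univ fun l _ => i3 k l]
      congr 1
      · congr 1
        · exact Finset.sum_congr rfl fun k _ => by rw [integral_const_mul, L2.inner_def]
        · exact Finset.sum_congr rfl fun k _ => by rw [integral_const_mul, L2.inner_def]
      · refine Finset.sum_congr rfl fun k _ => ?_
        rw [integral_finsetSum _ fun l _ => i3 k l]
        exact Finset.sum_congr rfl fun l _ => by
          rw [integral_const_mul, L2.inner_def (ψ l)]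
    have e2 : ∀ k, inner ℂ (R (η k)) (w k) = ((‖η k‖ ^ 2 : ℝ) : ℂ) := by
      intro k
      rw [hR.symm]
      change inner ℂ (η k) (η k) = _
      rw [inner_self_eq_norm_sq_to_K]
      norm_cast
    have e3 : ∀ k, inner ℂ (η k) (η k) = ((‖η k‖ ^ 2 : ℝ) : ℂ) := by
      intro k
      rw [inner_self_eq_norm_sq_to_K]
      norm_cast
    have e4 : ∀ k, ∑ l, (((c k * c l * μ k * μ l : ℝ) : ℂ) * inner ℂ (η k) (η l)) *
          inner ℂ (ψ l) (ψ k) = ((c k ^ 2 * μ k ^ 2 * ‖η k‖ ^ 2 : ℝ) : ℂ) := by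
      intro k
      rw [Finset.sum_eq_single k]
      · rw [orthonormal_iff_ite.1 hψ k k, if_pos rfl, e3]
        push_cast
        ring
      · intro l _ hl
        rw [orthonormal_iff_ite.1 hψ l k, if_neg hl, mul_zero]
      · simp
    rw [e1]
    simp only [e2, e3, e4]
    rw [← Finset.sum_sub_distrib, ← Finset.sum_sub_distrib, Complex.re_sum]
    refine Finset.sum_congr rfl fun k _ => ?_
    have h1 : 1 + μ k ≠ 0 := by have := hμ k; positivity
    rw [← Complex.ofReal_mul, ← Complex.ofReal_mul, ← Complex.ofReal_sub, ← Complex.ofReal_sub,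
      Complex.ofReal_re]
    simp only [c]
    field_simp
    ring
  have hGre : ∫ x, (Gc x).re = ∑ k, μ k / (1 + μ k) * ‖η k‖ ^ 2 := by
    rw [← hGint, ← Complex.reCLM_apply, ← ContinuousLinearMap.integral_comp_comm _ hGi]
    rfl
  rw [← hGre]
  refine (ofReal_integral_le_lintegral_ofReal hGi.re).trans ?_
  refine lintegral_mono_ae ?_
  have a1 := ae_all_iff.2 fun k => hM (ψ k)
  have a2 := ae_all_iff.2 fun k => hM (η k)
  have a3 := ae_all_iff.2 fun k => Lp.coeFn_smul ((μ k : ℝ) : ℂ) (ψ k)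
  have a4 := ae_all_iff.2 fun k => hR.ae_eq_resolventEval hd ht (η k)
  filter_upwards [a1, a2, a3, a4] with x h1 h2 h3 h4
  have hWη : ∀ k, W x (η k x) = ((μ k : ℝ) : ℂ) • ψ k x := by
    intro k
    rw [← h2 k, ← Pi.smul_apply, ← h3 k]
    exact congrArg (fun u : L2 d N => u x) (heig k)
  let α : Fin N → ι → ℂ := fun j k => (c k : ℂ) * inner ℂ (η k x) (b x j)
  let ω : Fin N → L2 d N := fun j => ∑ k, α j k • w k
  have hRω : ∀ j, R (ω j) = ∑ k, α j k • η k := by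
    intro j
    simp [ω, hη]
  refine le_trans ?_ (Finset.sum_le_sum fun j _ =>
    ofReal_variational_le hd ht hR x (hv x j) ((b x).norm_eq_one j) (ω j))
  refine le_trans (le_of_eq (congrArg ENNReal.ofReal ?_)) (ofReal_finsetSum_le _ _)
  have hαc : ∀ j k, starRingEnd ℂ (α j k) = (c k : ℂ) * inner ℂ (b x j) (η k x) := by
    intro j k
    simp only [α, map_mul, Complex.conj_ofReal, inner_conj_symm]
  have t1 : ∀ j, ((v x j : ℝ) : ℂ) * inner ℂ (resolventEval t x (R (ω j))) (b x j) =
      ∑ k, (c k : ℂ) * ((v x j : ℂ) * (inner ℂ (b x j) (η k x) * inner ℂ (R (η k) x) (b x j))) := by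
    intro j
    rw [hRω, resolventEval_sum_smul hd ht, sum_inner, Finset.mul_sum]
    refine Finset.sum_congr rfl fun k _ => ?_
    rw [inner_smul_left, hαc, h4 k]
    ring
  have t2 : ∀ j, inner ℂ (ω j) (R (ω j)) =
      ∑ k, ((c k ^ 2 * μ k : ℝ) : ℂ) * (inner ℂ (η k x) (b x j) * inner ℂ (b x j) (η k x)) := by
    intro j
    rw [hRω, inner_sum_smul_sum_smul]
    refine Finset.sum_congr rfl fun k _ => ?_
    simp only [hwη]
    rw [Finset.sum_eq_single k]
    · rw [if_pos rfl, hαc]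
      simp only [α]
      push_cast
      ring
    · intro l _ hl
      rw [if_neg (Ne.symm hl), mul_zero]
    · simp
  have t3 : ∀ j, ((v x j : ℝ) : ℂ) * inner ℂ (R (ω j)) (R (ω j)) =
      ∑ k, ∑ l, (((c k * c l : ℝ) : ℂ) * inner ℂ (η k) (η l)) *
        ((v x j : ℂ) * (inner ℂ (b x j) (η k x) * inner ℂ (η l x) (b x j))) := by
    intro j
    rw [hRω, inner_sum_smul_sum_smul, Finset.mul_sum]
    refine Finset.sum_congr rfl fun k _ => ?_
    rw [Finset.mul_sum]
    refine Finset.sum_congr rfl fun l _ => ?_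
    rw [hαc]
    simp only [α]
    push_cast
    ring
  have key : Gc x = ∑ j, (2 * (((v x j : ℝ) : ℂ) * inner ℂ (resolventEval t x (R (ω j))) (b x j))
      - inner ℂ (ω j) (R (ω j)) - ((v x j : ℝ) : ℂ) * inner ℂ (R (ω j)) (R (ω j))) := by
    rw [Finset.sum_sub_distrib, Finset.sum_sub_distrib, ← Finset.mul_sum]
    simp only [Gc, t1, t2, t3]
    congr 1
    · congr 1
      · rw [Finset.sum_comm, Finset.mul_sum]
        refine Finset.sum_congr rfl fun k _ => ?_
        rw [← Finset.mul_sum, sum_mul_inner_mul_inner (b x) (W x) (v x) (hv x) (hWb x) (hWη k),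
          h1 k]
        push_cast
        ring
      · rw [Finset.sum_comm]
        refine Finset.sum_congr rfl fun k _ => ?_
        rw [← Finset.mul_sum, (b x).sum_inner_mul_inner]
    · rw [eq_comm, Finset.sum_comm]
      refine Finset.sum_congr rfl fun k _ => ?_
      rw [Finset.sum_comm]
      refine Finset.sum_congr rfl fun l _ => ?_
      rw [← Finset.mul_sum, sum_mul_inner_mul_inner' (b x) (W x) (v x) (hv x) (hWb x) (hWη k)
        (hWη l)]
      push_cast
      ring
  change (Gc x).re = _
  rw [key, Complex.re_sum]
  refine Finset.sum_congr rfl fun j _ => ?_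
  have e5 : inner ℂ (R (ω j)) (R (ω j)) = ((‖R (ω j)‖ ^ 2 : ℝ) : ℂ) := by
    rw [inner_self_eq_norm_sq_to_K]
    norm_cast
  rw [e5, Complex.sub_re, Complex.sub_re, ← mul_assoc,
    show (2 : ℂ) * ((v x j : ℝ) : ℂ) = ((2 * v x j : ℝ) : ℂ) by push_cast; rfl,
    Complex.re_ofReal_mul, Complex.re_ofReal_mul, Complex.ofReal_re]

end ResolventTraceInequality

section PhaseSpaceBound

open scoped FourierTransform ENNReal NNReal

variable {d N : ℕ}

/-- The phase space integral of `tr φ(V / h)`, `φ x = x - log (1 + x)`, where `h` is the symbol of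
`-Δ + t` and `v` are the eigenvalues of `V`. -/
noncomputable def phaseSubLog (v : Space d → Fin N → ℝ) (t : ℝ) : ℝ≥0∞ :=
  ∫⁻ x, ∑ j, ∫⁻ p : Space d, ENNReal.ofReal (subLog (v x j / laplaceSymbol t p))

/-- The phase space integral of `tr V² / (h² (h + V))`, i.e. minus the derivative of `phaseSubLog`
with respect to `t`. -/
noncomputable def phaseResolvent (v : Space d → Fin N → ℝ) (t : ℝ) : ℝ≥0∞ :=
  ∫⁻ x, ∑ j, ∫⁻ p : Space d, ENNReal.ofReal
    (v x j ^ 2 / (laplaceSymbol t p ^ 2 * (laplaceSymbol t p + v x j)))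

theorem subLog_div_add_le {h h' v : ℝ} (hh : 0 < h) (hle : h ≤ h') (hv : 0 ≤ v) :
    subLog (v / h') + (h' - h) * (v ^ 2 / (h' ^ 2 * (h' + v))) ≤ subLog (v / h) := by
  have hh' := hh.trans_le hle
  refine le_trans ?_ (subLog_tangent (a := v / h') (b := v / h) (by positivity) (by positivity))
  have h1 : v / h' / (1 + v / h') * (v / h - v / h') = (h' - h) * (v ^ 2 / ((h' * h) * (h' + v))) := by
    field_simp
  rw [h1]
  have h2 : 0 ≤ h' - h := by linarith
  have h3 : h' * h ≤ h' ^ 2 := by rw [sq]; gcongr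
  gcongr

theorem phaseSubLog_add_le (hd : 0 < d) {v : Space d → Fin N → ℝ} (hv : ∀ x j, 0 ≤ v x j)
    {s t : ℝ} (hs : 0 ≤ s) (hst : s ≤ t) :
    phaseSubLog v t + ENNReal.ofReal (t - s) * phaseResolvent v t ≤ phaseSubLog v s := by
  unfold phaseSubLog phaseResolvent
  rw [← lintegral_const_mul' _ _ ENNReal.ofReal_ne_top]
  refine (le_lintegral_add _ _).trans (lintegral_mono fun x => ?_)
  rw [Finset.mul_sum, ← Finset.sum_add_distrib]
  refine Finset.sum_le_sum fun j _ => ?_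
  rw [← lintegral_const_mul' _ _ ENNReal.ofReal_ne_top]
  refine (le_lintegral_add _ _).trans (lintegral_mono_ae ?_)
  filter_upwards [ae_ne_zero_space hd] with p hp
  have hps : 0 < laplaceSymbol s p := by
    unfold laplaceSymbol
    have := norm_pos_iff.2 hp
    positivity
  have hle : laplaceSymbol s p ≤ laplaceSymbol t p := by unfold laplaceSymbol; linarith
  have hd' : t - s = laplaceSymbol t p - laplaceSymbol s p := by unfold laplaceSymbol; ring
  have hpt := hps.trans_le hle
  have hvj := hv x j
  rw [← ENNReal.ofReal_mul (by linarith), ← ENNReal.ofReal_add (subLog_nonneg (by positivity))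
    (mul_nonneg (by linarith) (by positivity)), hd']
  exact ENNReal.ofReal_le_ofReal (subLog_div_add_le hps hle hvj)

theorem phaseResolvent_lt_top (hd : 0 < d) {v : Space d → Fin N → ℝ} (hv : ∀ x j, 0 ≤ v x j)
    (hfin : phaseSubLog v 0 < ∞) {t : ℝ} (ht : 0 < t) : phaseResolvent v t < ∞ := by
  have h := (le_add_self.trans (phaseSubLog_add_le hd hv le_rfl ht.le)).trans_lt hfin
  rw [sub_zero] at h
  by_contra hcon
  rw [not_lt, top_le_iff] at hcon
  rw [hcon, ENNReal.mul_top (by simpa using ht)] at h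
  exact lt_irrefl _ h

section Main

variable {W : Space d → EuclideanSpace ℂ (Fin N) →L[ℂ] EuclideanSpace ℂ (Fin N)}
    {b : Space d → OrthonormalBasis (Fin N) ℂ (EuclideanSpace ℂ (Fin N))}
    {v : Space d → Fin N → ℝ}
    {M : L2 d N →L[ℂ] L2 d N}

theorem supSubLog_sandwich_step (hd : d = 3) (hW : MemLp W 2 volume) (hv : ∀ x j, 0 ≤ v x j)
    (hWb : ∀ x j, W x (b x j) = ((Real.sqrt (v x j) : ℝ) : ℂ) • b x j)
    (hM : ∀ u, ∀ᵐ x, M u x = W x (u x))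
    {s t : ℝ} (hs : 0 < s) (hst : s ≤ t) {R R' : L2 d N →L[ℂ] L2 d N} (hR : IsResolvent s R)
    (hR' : IsResolvent t R') :
    supSubLog (M ∘L R ∘L M) ≤
      ENNReal.ofReal (t - s) * phaseResolvent v s + supSubLog (M ∘L R' ∘L M) := by
  have hsymm : ∀ x a a', inner ℂ (W x a) a' = inner ℂ a (W x a') := fun x =>
    inner_symm_of_orthonormalBasis (b x) (W x) _ (hWb x)
  have hMs := inner_mul_symm hsymm hM
  obtain ⟨C, -, hC⟩ := exists_sum_norm_fourier_sq_le hW hsymm M hM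
  have ht := hs.trans_le hst
  refine supSubLog_le_of_eigenvectors _ (isCompactOperator_sandwich hd hs hR hC)
    (isPositive_sandwich hs hMs hR) _ fun ι _ e μ he hμ heig => ?_
  have hre : ∀ (Q : L2 d N →L[ℂ] L2 d N) u, inner ℂ u ((M ∘L Q ∘L M) u) = inner ℂ (M u) (Q (M u)) := by
    intro Q u
    simp only [ContinuousLinearMap.comp_apply]
    rw [hMs]
  have hμe : ∀ i, μ i = (inner ℂ (M (e i)) (R (M (e i)))).re := by
    intro i
    rw [← hre, heig, inner_smul_right, inner_self_eq_norm_sq_to_K, he.1 i]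
    simp
  set β : ι → ℝ := fun i => (inner ℂ (e i) ((M ∘L R' ∘L M) (e i))).re with hβ
  have hβ0 : ∀ i, 0 ≤ β i := fun i => (isPositive_sandwich ht hMs hR').re_inner_nonneg_right (e i)
  have h1 : ∑ i, subLog (μ i) ≤
      (t - s) * (∑ i, μ i / (1 + μ i) * ‖R (M (e i))‖ ^ 2) + ∑ i, subLog (β i) := by
    rw [Finset.mul_sum, ← Finset.sum_add_distrib]
    refine Finset.sum_le_sum fun i _ => ?_
    have h2 := subLog_tangent (hμ i) (hβ0 i)
    have h3 : μ i - β i ≤ (t - s) * ‖R (M (e i))‖ ^ 2 := by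
      rw [hμe, hβ]
      simp only [hre]
      exact IsResolvent.re_inner_sub_le hs hst hR hR' _
    have h4 : 0 ≤ μ i / (1 + μ i) := by have := hμ i; positivity
    have h5 := mul_le_mul_of_nonneg_left h3 h4
    linarith
  refine (ENNReal.ofReal_le_ofReal h1).trans (ENNReal.ofReal_add_le.trans ?_)
  refine add_le_add ?_ (ofReal_sum_subLog_le_supSubLog _ e he)
  rw [ENNReal.ofReal_mul (by linarith)]
  gcongr
  exact ofReal_sum_resolvent_le hd hs b v hv hWb hM hR e he μ hμ heig

theorem supSubLog_sandwich_le_phaseSubLog (hd : d = 3) (hW : MemLp W 2 volume)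
    (hv : ∀ x j, 0 ≤ v x j)
    (hWb : ∀ x j, W x (b x j) = ((Real.sqrt (v x j) : ℝ) : ℂ) • b x j)
    (hM : ∀ u, ∀ᵐ x, M u x = W x (u x)) (hfin : phaseSubLog v 0 < ∞)
    {s : ℝ} (hs : 0 < s) {R : L2 d N →L[ℂ] L2 d N} (hR : IsResolvent s R) :
    supSubLog (M ∘L R ∘L M) ≤ phaseSubLog v 0 := by
  have hd0 : 0 < d := by omega
  have hsymm : ∀ x a a', inner ℂ (W x a) a' = inner ℂ a (W x a') := fun x =>
    inner_symm_of_orthonormalBasis (b x) (W x) _ (hWb x)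
  have hMs := inner_mul_symm hsymm hM
  obtain ⟨C, hC0, hC⟩ := exists_sum_norm_fourier_sq_le hW hsymm M hM
  choose Q hQ using fun t : Ioi (0 : ℝ) => exists_isResolvent (d := d) (N := N) t.2
  have hmesh : ∀ (δ : ℝ) (hδ : 0 < δ) (n : ℕ),
      supSubLog (M ∘L R ∘L M) + phaseSubLog v (s + n * δ) +
        ENNReal.ofReal δ * phaseResolvent v (s + n * δ) ≤
      ENNReal.ofReal δ * phaseResolvent v s + phaseSubLog v s +
        supSubLog (M ∘L Q ⟨s + n * δ, by simp only [mem_Ioi]; positivity⟩ ∘L M) := by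
    intro δ hδ n
    induction n with
    | zero =>
      have h0 := supSubLog_sandwich_step hd hW hv hWb hM hs
        (le_of_eq (by simp : s = s + ((0 : ℕ) : ℝ) * δ)) hR
        (hQ ⟨s + ((0 : ℕ) : ℝ) * δ, by simp only [mem_Ioi]; positivity⟩)
      have e0 : s + ((0 : ℕ) : ℝ) * δ - s = 0 := by simp
      have e1 : s + ((0 : ℕ) : ℝ) * δ = s := by simp
      rw [e0, ENNReal.ofReal_zero, zero_mul, zero_add] at h0
      have h0' := add_le_add_left h0
        (ENNReal.ofReal δ * phaseResolvent v s + phaseSubLog v s)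
      refine le_trans (le_of_eq ?_) (h0'.trans (le_of_eq (add_comm _ _)))
      rw [e1]
      ring
    | succ n ih =>
      have hn : 0 < s + n * δ := by positivity
      have hn1 : s + n * δ ≤ s + ((n + 1 : ℕ) : ℝ) * δ := by push_cast; linarith
      have hdiff : s + ((n + 1 : ℕ) : ℝ) * δ - (s + n * δ) = δ := by push_cast; ring
      have h1 := phaseSubLog_add_le hd0 hv hn.le hn1
      rw [hdiff] at h1
      have h2 := supSubLog_sandwich_step hd hW hv hWb hM hn hn1
        (hQ ⟨s + n * δ, by simp only [mem_Ioi]; positivity⟩)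
        (hQ ⟨s + ((n + 1 : ℕ) : ℝ) * δ, by simp only [mem_Ioi]; positivity⟩)
      rw [hdiff] at h2
      have hfinS : ENNReal.ofReal δ * phaseResolvent v (s + n * δ) ≠ ∞ :=
        ENNReal.mul_ne_top ENNReal.ofReal_ne_top (phaseResolvent_lt_top hd0 hv hfin hn).ne
      rw [add_assoc]
      refine (add_le_add le_rfl h1).trans ?_
      refine (ENNReal.add_le_add_iff_right hfinS).1 ?_
      refine ih.trans ((add_le_add le_rfl h2).trans (le_of_eq ?_))
      ring
  have hlim : ∀ δ : ℝ, 0 < δ → supSubLog (M ∘L R ∘L M) ≤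
      ENNReal.ofReal δ * phaseResolvent v s + phaseSubLog v s := by
    intro δ hδ
    have h1 : Filter.Tendsto (fun n : ℕ => s + n * δ) Filter.atTop Filter.atTop :=
      Filter.tendsto_atTop_add_const_left _ _
        (tendsto_natCast_atTop_atTop.atTop_mul_const hδ)
    have h2 := (tendsto_integral_inv_laplaceSymbol_sq hd).comp h1
    have h3 := ENNReal.tendsto_ofReal ((h2.const_mul C).const_mul (‖M‖ ^ 2))
    simp only [mul_zero, ENNReal.ofReal_zero] at h3
    have h4 := h3.const_add (ENNReal.ofReal δ * phaseResolvent v s + phaseSubLog v s)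
    rw [add_zero] at h4
    refine ge_of_tendsto' h4 fun n => ?_
    refine (le_add_right (le_add_right le_rfl)).trans ((hmesh δ hδ n).trans ?_)
    have hpos : 0 < s + n * δ := by positivity
    exact add_le_add le_rfl (supSubLog_sandwich_le hd hpos hMs (hQ ⟨s + n * δ, hpos⟩) hC)
  have hle : supSubLog (M ∘L R ∘L M) ≤ phaseSubLog v s := by
    have h1 : Filter.Tendsto (fun δ : ℝ => ENNReal.ofReal δ * phaseResolvent v s + phaseSubLog v s)
        (nhdsWithin 0 (Ioi 0)) (nhds (0 * phaseResolvent v s + phaseSubLog v s)) := by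
      refine Filter.Tendsto.add_const _ (ENNReal.Tendsto.mul_const ?_
        (Or.inr (phaseResolvent_lt_top hd0 hv hfin hs).ne))
      rw [← ENNReal.ofReal_zero]
      exact ENNReal.tendsto_ofReal nhdsWithin_le_nhds
    rw [zero_mul, zero_add] at h1
    exact ge_of_tendsto h1 (Filter.eventually_of_mem self_mem_nhdsWithin fun δ hδ => hlim δ hδ)
  exact hle.trans ((le_add_right le_rfl).trans (phaseSubLog_add_le hd0 hv le_rfl hs.le))

/-- The bound `Tr φ(K) ≤ ∬ tr φ(V / |2πp|²)`, `φ x = x - log (1 + x)`, for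
`K = V^{1/2} (-Δ)⁻¹ V^{1/2}` in three dimensions. -/
theorem ofReal_sum_subLog_le_phaseSubLog (hd : d = 3) (hW : MemLp W 2 volume)
    (hv : ∀ x j, 0 ≤ v x j)
    (hWb : ∀ x j, W x (b x j) = ((Real.sqrt (v x j) : ℝ) : ℂ) • b x j)
    (hM : ∀ u, ∀ᵐ x, M u x = W x (u x)) {A : L2 d N →L[ℂ] L2 d N}
    (hA : ∀ u, IsInvSqrtLaplacian (M u) (A u))
    {ι : Type} [Fintype ι] (ψ : ι → L2 d N) (hψ : Orthonormal ℂ ψ) (μ : ι → ℝ) (hμ : ∀ i, 0 ≤ μ i)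
    (heig : ∀ i, ((ContinuousLinearMap.adjoint A).comp A) (ψ i) = ((μ i : ℝ) : ℂ) • ψ i) :
    ENNReal.ofReal (∑ i, subLog (μ i)) ≤ phaseSubLog v 0 := by
  rcases eq_or_ne (phaseSubLog v 0) ∞ with htop | hfin
  · rw [htop]; exact le_top
  have hsymm : ∀ x a a', inner ℂ (W x a) a' = inner ℂ a (W x a') := fun x =>
    inner_symm_of_orthonormalBasis (b x) (W x) _ (hWb x)
  have hMs := inner_mul_symm hsymm hM
  let s : ℕ → ℝ := fun n => 1 / ((n : ℝ) + 1)
  have hs : ∀ n, 0 < s n := fun n => Nat.one_div_pos_of_nat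
  choose R hR using fun n => exists_isResolvent (d := d) (N := N) (hs n)
  have hμA : ∀ i, μ i = ∫ p, ‖(𝓕 (A (ψ i)) : L2 d N) p‖ ^ 2 := by
    intro i
    rw [← norm_sq_Lp_two_eq_integral, Lp.norm_fourier_eq]
    have h1 := congrArg (fun u => inner ℂ (ψ i) u) (heig i)
    simp only [ContinuousLinearMap.comp_apply, ContinuousLinearMap.adjoint_inner_right,
      inner_smul_right] at h1
    rw [inner_self_eq_norm_sq_to_K, inner_self_eq_norm_sq_to_K, hψ.1 i] at h1
    have h2 : ((‖A (ψ i)‖ ^ 2 : ℝ) : ℂ) = ((μ i : ℝ) : ℂ) := by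
      push_cast
      simpa using h1
    exact (Complex.ofReal_injective h2).symm
  have hconv : ∀ i, Filter.Tendsto (fun n => (inner ℂ (ψ i) ((M ∘L R n ∘L M) (ψ i))).re)
      Filter.atTop (nhds (μ i)) := by
    intro i
    have e1 : ∀ n, (inner ℂ (ψ i) ((M ∘L R n ∘L M) (ψ i))).re =
        ∫ p, ((laplaceSymbol (s n) p)⁻¹ * (2 * Real.pi * ‖p‖) ^ 2) *
          ‖(𝓕 (A (ψ i)) : L2 d N) p‖ ^ 2 := by
      intro n
      simp only [ContinuousLinearMap.comp_apply]
      rw [← hMs, (hR n).re_inner_eq (hs n)]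
      refine integral_congr_ae ?_
      filter_upwards [hA (ψ i)] with p hp
      rw [hp, norm_smul, mul_pow, Complex.norm_real, Real.norm_eq_abs, sq_abs]
      ring
    simp only [e1]
    rw [hμA i]
    refine tendsto_integral_of_dominated_convergence
      (fun p => ‖(𝓕 (A (ψ i)) : L2 d N) p‖ ^ 2) (fun n => ?_)
      ((memLp_two_iff_integrable_sq_norm (Lp.aestronglyMeasurable _)).1 (Lp.memLp _)) (fun n => ?_) ?_
    · refine AEStronglyMeasurable.mul ?_ ((Lp.aestronglyMeasurable _).norm.pow 2)
      exact ((measurable_inv_laplaceSymbol (s n)).mul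
        (by fun_prop : Measurable fun p : Space d =>
          (2 * Real.pi * ‖p‖) ^ 2)).aestronglyMeasurable
    · refine Filter.Eventually.of_forall fun p => ?_
      have h1 := laplaceSymbol_pos (hs n) p
      rw [Real.norm_of_nonneg (by positivity)]
      refine mul_le_of_le_one_left (sq_nonneg _) ?_
      rw [inv_mul_le_iff₀ h1, mul_one]
      unfold laplaceSymbol
      linarith [hs n]
    · filter_upwards [ae_ne_zero_space (d := d) (by omega)] with p hp
      have hp' := norm_pos_iff.2 hp
      have h1 : Filter.Tendsto (fun n => laplaceSymbol (s n) p) Filter.atTop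
          (nhds ((2 * Real.pi * ‖p‖) ^ 2 + 0)) :=
        tendsto_const_nhds.add tendsto_one_div_add_atTop_nhds_zero_nat
      have h2 := ((h1.inv₀ (by positivity)).mul_const ((2 * Real.pi * ‖p‖) ^ 2)).mul_const
        (‖(𝓕 (A (ψ i)) : L2 d N) p‖ ^ 2)
      rwa [add_zero, inv_mul_cancel₀ (by positivity), one_mul] at h2
  have hcont : ∀ i, Filter.Tendsto (fun n => subLog (inner ℂ (ψ i) ((M ∘L R n ∘L M) (ψ i))).re)
      Filter.atTop (nhds (subLog (μ i))) := by
    intro i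
    have h1 : ContinuousAt subLog (μ i) := by
      unfold subLog
      have : (1 + μ i) ≠ 0 := by have := hμ i; positivity
      fun_prop (disch := assumption)
    exact h1.tendsto.comp (hconv i)
  have hlim := ENNReal.tendsto_ofReal (tendsto_finsetSum Finset.univ fun i _ => hcont i)
  refine le_of_tendsto' hlim fun n => ?_
  exact (ofReal_sum_subLog_le_supSubLog _ ψ hψ).trans
    (supSubLog_sandwich_le_phaseSubLog hd hW hv hWb hM (lt_top_iff_ne_top.2 hfin) (hs n) (hR n))

end Main

end PhaseSpaceBound

section ExpRemainder

open scoped ENNReal NNReal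

/-- The function `g_α(s) = e^{-αs} - 1 + αs`. -/
noncomputable def expRemainder (α s : ℝ) : ℝ := Real.exp (-(α * s)) - 1 + α * s

/-- The integral `∫_0^∞ f(s) s^{-d/2-1} ds`. -/
noncomputable def semiclassicalConst (d : ℕ) (f : ℝ → ℝ) : ℝ≥0∞ :=
  ∫⁻ s in Ioi (0 : ℝ), ENNReal.ofReal (f s * s ^ (-((d : ℝ) / 2) - 1))

theorem expRemainder_nonneg (α s : ℝ) : 0 ≤ expRemainder α s := by
  have := Real.add_one_le_exp (-(α * s))
  unfold expRemainder
  linarith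

theorem measurable_expRemainder : Measurable fun q : ℝ × ℝ => expRemainder q.1 q.2 := by
  unfold expRemainder
  fun_prop

theorem expRemainder_mul_inv_eq (α : ℝ) {s : ℝ} (hs : 0 < s) :
    expRemainder α s * s⁻¹ = ∫ β in (0 : ℝ)..α, (1 - Real.exp (-(β * s))) := by
  have h : ∀ β ∈ uIcc 0 α, HasDerivAt (fun β => β + Real.exp (-(β * s)) * s⁻¹)
      (1 - Real.exp (-(β * s))) β := by
    intro β _
    have h1 : HasDerivAt (fun β : ℝ => -(β * s)) (-(1 * s)) β := ((hasDerivAt_id β).mul_const s).neg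
    have h2 := (hasDerivAt_id β).add (h1.exp.mul_const s⁻¹)
    refine h2.congr_deriv ?_
    field_simp
    ring
  rw [intervalIntegral.integral_eq_sub_of_hasDerivAt h
    (Continuous.intervalIntegrable (by fun_prop) _ _)]
  unfold expRemainder
  simp only [zero_mul, neg_zero, Real.exp_zero]
  field_simp
  ring

theorem lintegral_one_sub_exp_mul_exp {β lam : ℝ} (hβ : 0 < β) (hlam : 0 < lam) :
    ∫⁻ s in Ioi (0 : ℝ), ENNReal.ofReal ((1 - Real.exp (-(β * s))) * Real.exp (-(s / lam))) =
      ENNReal.ofReal (lam - lam / (1 + β * lam)) := by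
  have hl : -lam⁻¹ < 0 := by simpa using hlam
  have hl2 : -(β + lam⁻¹) < 0 := by have := inv_pos.2 hlam; linarith
  have e : ∀ s, (1 - Real.exp (-(β * s))) * Real.exp (-(s / lam)) =
      Real.exp (-lam⁻¹ * s) - Real.exp (-(β + lam⁻¹) * s) := by
    intro s
    rw [sub_mul, one_mul, ← Real.exp_add]
    congr 2
    · field_simp
    · field_simp; ring
  have h1 := integrableOn_exp_mul_Ioi hl 0
  have h2 := integrableOn_exp_mul_Ioi hl2 0
  rw [← ofReal_integral_eq_lintegral_ofReal]
  · simp only [e]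
    rw [integral_sub h1 h2, integral_exp_mul_Ioi hl, integral_exp_mul_Ioi hl2]
    congr 1
    simp only [mul_zero, Real.exp_zero]
    have : 1 + β * lam ≠ 0 := by positivity
    have : β + lam⁻¹ ≠ 0 := by positivity
    field_simp
    ring
  · simp only [e]
    exact h1.sub h2
  · filter_upwards [ae_restrict_mem measurableSet_Ioi] with s hs
    have : Real.exp (-(β * s)) ≤ 1 := Real.exp_le_one_iff.2 (by
      have := mul_pos hβ hs; linarith)
    exact mul_nonneg (by linarith) (Real.exp_pos _).le

theorem transformF_expRemainder {α lam : ℝ} (hα : 0 < α) (hlam : 0 < lam) :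
    transformF (expRemainder α) lam = ENNReal.ofReal (subLog (α * lam)) := by
  have h1 : ∀ s ∈ Ioi (0 : ℝ),
      ENNReal.ofReal (expRemainder α s * Real.exp (-(s / lam)) * s⁻¹) =
      ∫⁻ β in Ioc 0 α, ENNReal.ofReal ((1 - Real.exp (-(β * s))) * Real.exp (-(s / lam))) := by
    intro s hs
    rw [mul_right_comm, expRemainder_mul_inv_eq α hs, intervalIntegral.integral_of_le hα.le,
      ← integral_mul_const, ofReal_integral_eq_lintegral_ofReal]
    · exact ((Continuous.intervalIntegrable (by fun_prop) 0 α).1)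
    · filter_upwards [ae_restrict_mem measurableSet_Ioc] with β hβ
      have : Real.exp (-(β * s)) ≤ 1 := Real.exp_le_one_iff.2 (by
        have := mul_pos hβ.1 hs; linarith)
      exact mul_nonneg (by linarith) (Real.exp_pos _).le
  unfold transformF
  rw [setLIntegral_congr_fun measurableSet_Ioi h1, lintegral_lintegral_swap
    (Measurable.aemeasurable (by unfold Function.uncurry; fun_prop)),
    setLIntegral_congr_fun measurableSet_Ioc fun β hβ => lintegral_one_sub_exp_mul_exp hβ.1 hlam]
  have h2 : ∀ β ∈ uIcc 0 α, HasDerivAt (fun β => β * lam - Real.log (1 + β * lam))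
      (lam - lam / (1 + β * lam)) β := by
    intro β hβ
    rw [uIcc_of_le hα.le] at hβ
    have h3 : HasDerivAt (fun β : ℝ => 1 + β * lam) (1 * lam) β :=
      ((hasDerivAt_id β).mul_const lam).const_add 1
    have h4 : 1 + β * lam ≠ 0 := by have := mul_nonneg hβ.1 hlam.le; positivity
    have := ((hasDerivAt_id β).mul_const lam).sub (h3.log h4)
    refine this.congr_deriv ?_
    ring
  have h3 : IntervalIntegrable (fun β => lam - lam / (1 + β * lam)) volume 0 α := by
    refine ContinuousOn.intervalIntegrable fun β hβ => ?_
    rw [uIcc_of_le hα.le] at hβ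
    have h4 : 1 + β * lam ≠ 0 := by have := mul_nonneg hβ.1 hlam.le; positivity
    exact ContinuousAt.continuousWithinAt (by fun_prop (disch := assumption))
  have h4 := intervalIntegral.integral_eq_sub_of_hasDerivAt h2 h3
  rw [intervalIntegral.integral_of_le hα.le] at h4
  rw [← ofReal_integral_eq_lintegral_ofReal h3.1, h4]
  · simp [subLog]
  · filter_upwards [ae_restrict_mem measurableSet_Ioc] with β hβ
    have h5 := mul_pos hβ.1 hlam
    have : lam / (1 + β * lam) ≤ lam := div_le_self hlam.le (by linarith)
    simpa using this

theorem lintegral_ofReal_exp_neg_sq_norm (d : ℕ) {b : ℝ} (hb : 0 < b) :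
    ∫⁻ p : Space d, ENNReal.ofReal (Real.exp (-b * ‖p‖ ^ 2)) =
      ENNReal.ofReal ((Real.pi / b) ^ ((d : ℝ) / 2)) := by
  have h := GaussianFourier.integral_rexp_neg_mul_sq_norm (V := Space d) hb
  rw [finrank_euclideanSpace_fin] at h
  rw [← h, ofReal_integral_eq_lintegral_ofReal]
  · by_contra hn
    rw [integral_undef hn] at h
    have : 0 < (Real.pi / b) ^ ((d : ℝ) / 2) := by have := Real.pi_pos; positivity
    linarith
  · exact Filter.Eventually.of_forall fun p => (Real.exp_pos _).le

/-- The integral of `φ(α v / |2πp|²)` over momentum space, `φ x = x - log (1 + x)`. -/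
theorem lintegral_subLog_div_laplaceSymbol {d : ℕ} (hd : 0 < d) {α v : ℝ} (hα : 0 < α)
    (hv : 0 ≤ v) :
    ∫⁻ p : Space d, ENNReal.ofReal (subLog (α * v / laplaceSymbol 0 p)) =
      ENNReal.ofReal ((4 * Real.pi) ^ (-((d : ℝ) / 2))) * semiclassicalConst d (expRemainder α) *
        ENNReal.ofReal (v ^ ((d : ℝ) / 2)) := by
  have hpi := Real.pi_pos
  rcases hv.eq_or_lt with rfl | hv
  · have : (0 : ℝ) ^ ((d : ℝ) / 2) = 0 := Real.zero_rpow (by positivity)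
    simp [subLog_zero, this]
  have h1 : ∀ᵐ p : Space d, ENNReal.ofReal (subLog (α * v / laplaceSymbol 0 p)) =
      ∫⁻ s in Ioi (0 : ℝ), ENNReal.ofReal (expRemainder α s * s⁻¹) *
        ENNReal.ofReal (Real.exp (-(4 * Real.pi ^ 2 * s / v) * ‖p‖ ^ 2)) := by
    filter_upwards [ae_ne_zero_space hd] with p hp
    have hp' := norm_pos_iff.2 hp
    have hL : laplaceSymbol 0 p = (2 * Real.pi * ‖p‖) ^ 2 := by simp [laplaceSymbol]
    rw [mul_div_assoc, hL, ← transformF_expRemainder hα (by positivity)]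
    refine setLIntegral_congr_fun measurableSet_Ioi fun s hs => ?_
    have hs' : 0 < s := hs
    have := expRemainder_nonneg α s
    rw [← ENNReal.ofReal_mul (by positivity), mul_right_comm]
    congr 3
    field_simp
    norm_num
  rw [lintegral_congr_ae h1, lintegral_lintegral_swap]
  swap
  · have m1 : Measurable fun q : Space d × ℝ => ENNReal.ofReal (expRemainder α q.2 * q.2⁻¹) :=
      ENNReal.measurable_ofReal.comp (Measurable.mul
        (measurable_expRemainder.comp (measurable_const.prodMk measurable_snd)) measurable_snd.inv)
    have m2 : Measurable fun q : Space d × ℝ =>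
        ENNReal.ofReal (Real.exp (-(4 * Real.pi ^ 2 * q.2 / v) * ‖q.1‖ ^ 2)) := by fun_prop
    exact (m1.mul m2).aemeasurable
  unfold semiclassicalConst
  rw [← lintegral_const_mul' _ _ ENNReal.ofReal_ne_top,
    ← lintegral_mul_const' _ _ ENNReal.ofReal_ne_top]
  refine setLIntegral_congr_fun measurableSet_Ioi fun s hs => ?_
  have hs' : 0 < s := hs
  have hg := expRemainder_nonneg α s
  rw [lintegral_const_mul' _ _ ENNReal.ofReal_ne_top,
    lintegral_ofReal_exp_neg_sq_norm d (by positivity), ← ENNReal.ofReal_mul (by positivity),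
    ← ENNReal.ofReal_mul (by positivity), ← ENNReal.ofReal_mul (by positivity)]
  congr 1
  have h2 : Real.pi / (4 * Real.pi ^ 2 * s / v) = (4 * Real.pi)⁻¹ * s⁻¹ * v := by
    field_simp
  rw [h2, Real.mul_rpow (by positivity) hv.le, Real.mul_rpow (by positivity) (by positivity),
    Real.rpow_sub hs', Real.rpow_one, Real.rpow_neg hs'.le, Real.rpow_neg (by positivity),
    Real.inv_rpow (by positivity), Real.inv_rpow hs'.le]
  field_simp

/-! ### Divergence of the semiclassical constant -/

theorem eq_zero_of_rpow_le {d : ℕ} {f : ℝ → ℝ} (hf : semiclassicalConst d f ≠ ∞) {c r : ℝ}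
    (hc : 0 ≤ c) (h : ∀ s, 0 < s → c * s ^ r ≤ f s) : c = 0 := by
  by_contra hne
  have hc' := lt_of_le_of_ne hc (Ne.symm hne)
  refine not_integrableOn_Ioi_rpow (r + (-((d : ℝ) / 2) - 1)) ?_
  refine (integrable_const_mul_iff (c := c) (IsUnit.mk0 c hne) _).1 ?_
  refine ⟨Measurable.aestronglyMeasurable (by fun_prop), ?_⟩
  rw [hasFiniteIntegral_iff_ofReal]
  · refine lt_of_le_of_lt (setLIntegral_mono' measurableSet_Ioi fun s hs => ?_)
      (lt_top_iff_ne_top.2 hf)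
    have hs' : 0 < s := hs
    refine ENNReal.ofReal_le_ofReal ?_
    rw [Real.rpow_add hs', ← mul_assoc]
    exact mul_le_mul_of_nonneg_right (h s hs) (by positivity)
  · filter_upwards [ae_restrict_mem measurableSet_Ioi] with s hs
    have hs' : 0 < s := hs
    simp only [Pi.zero_apply]
    positivity

theorem exists_lt_mul_rpow {d : ℕ} {f : ℝ → ℝ} (hf : semiclassicalConst d f ≠ ∞) {c r δ : ℝ}
    (hc : 0 < c) (hδ : 0 < δ) (hr : r ≤ (d : ℝ) / 2) : ∃ s, 0 < s ∧ s < δ ∧ f s < c * s ^ r := by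
  by_contra! h
  have h1 : ¬ IntegrableOn (fun s : ℝ => s ^ (r + (-((d : ℝ) / 2) - 1))) (Ioo 0 δ) := by
    rw [intervalIntegral.integrableOn_Ioo_rpow_iff hδ]
    linarith
  refine h1 ((integrable_const_mul_iff (c := c) (IsUnit.mk0 c hc.ne') _).1 ?_)
  refine ⟨Measurable.aestronglyMeasurable (by fun_prop), ?_⟩
  rw [hasFiniteIntegral_iff_ofReal]
  · refine lt_of_le_of_lt (le_trans (setLIntegral_mono' measurableSet_Ioo fun s hs => ?_)
      (lintegral_mono_set Ioo_subset_Ioi_self)) (lt_top_iff_ne_top.2 hf)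
    refine ENNReal.ofReal_le_ofReal ?_
    have hs' := hs.1
    rw [Real.rpow_add hs', ← mul_assoc]
    exact mul_le_mul_of_nonneg_right (h s hs.1 hs.2) (by positivity)
  · filter_upwards [ae_restrict_mem measurableSet_Ioo] with s hs
    have hs' := hs.1
    simp only [Pi.zero_apply]
    positivity

theorem expRemainder_lower_bound {α s : ℝ} (h : |α * s| ≤ 1) :
    (α * s) ^ 2 / 4 ≤ expRemainder α s := by
  have h1 := Real.exp_bound (x := -(α * s)) (by rwa [abs_neg]) (n := 3) (by norm_num)
  have h2 := (abs_le.1 h1).1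
  simp only [Finset.sum_range_succ, Finset.sum_range_zero, abs_neg] at h2
  norm_num [Nat.factorial] at h2
  have h3 : |α * s| ^ 3 ≤ (α * s) ^ 2 := by
    rw [pow_succ, sq_abs]
    exact mul_le_of_le_one_right (sq_nonneg _) h
  rw [abs_mul] at h3
  unfold expRemainder
  nlinarith [sq_nonneg (α * s)]

/-- The semiclassical constant of `g_α` is finite only if `α = 0`, or `α > 0` and `d = 3`. -/
theorem pos_of_semiclassicalConst_expRemainder {d : ℕ} (hd : 3 ≤ d) {α : ℝ} (hα : α ≠ 0)
    (h : semiclassicalConst d (expRemainder α) ≠ ∞) : 0 < α ∧ d = 3 := by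
  constructor
  · by_contra! hneg
    have h1 := eq_zero_of_rpow_le h (c := α ^ 2 / 2) (r := 2) (by positivity) fun s hs => by
      have h2 : 0 ≤ -(α * s) := by nlinarith
      have := Real.quadratic_le_exp_of_nonneg h2
      unfold expRemainder
      rw [Real.rpow_ofNat]
      nlinarith
    exact hα (by simpa using h1)
  · by_contra hne
    have h4 : (4 : ℝ) ≤ d := by exact_mod_cast (by omega : 4 ≤ d)
    have hα' := abs_pos.2 hα
    obtain ⟨s, hs, hsδ, hlt⟩ := exists_lt_mul_rpow h (c := α ^ 2 / 4) (r := 2) (δ := |α|⁻¹)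
      (by positivity) (by positivity) (by linarith)
    have h1 := expRemainder_lower_bound (α := α) (s := s) (by
      rw [abs_mul, abs_of_pos hs, ← mul_inv_cancel₀ hα'.ne']
      gcongr)
    rw [Real.rpow_ofNat] at hlt
    nlinarith

end ExpRemainder

section BirmanSchwinger

open scoped FourierTransform ENNReal NNReal

variable {d N : ℕ}

theorem inner_sqrtCLM_symm {B : Matrix (Fin N) (Fin N) ℂ} (hB : B.IsHermitian)
    (a a' : EuclideanSpace ℂ (Fin N)) :
    inner ℂ (sqrtCLM B a) a' = inner ℂ a (sqrtCLM B a') :=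
  inner_symm_of_orthonormalBasis hB.eigenvectorBasis _ _ (sqrtCLM_eigenvectorBasis hB) a a'

theorem exists_isBirmanSchwinger (hd : 3 ≤ d) {V : Space d → Matrix (Fin N) (Fin N) ℂ}
    (hV : ∀ x, (V x).PosSemidef) (hint : ∀ i j, MemLp (fun x => V x i j) 1 volume)
    (hb : ∀ i j, MemLp (fun x => V x i j) ⊤ volume) :
    ∃ K : L2 d N →L[ℂ] L2 d N, IsBirmanSchwinger V K := by
  obtain ⟨C, hC⟩ := exists_ae_norm_sqrtCLM_le hV hb
  obtain ⟨M, hM⟩ := exists_clm_apply_ae_eq (ContinuousLinearMap.id ℂ (L2 d N))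
    (fun x => sqrtCLM (V x)) (aestronglyMeasurable_sqrtCLM hV fun i j => (hint i j).1) C (by
      intro u
      rw [Lp.enorm_def]
      refine eLpNorm_le_nnreal_smul_eLpNorm_of_ae_le_mul ?_ 2
      filter_upwards [hC] with x hx
      have := (sqrtCLM (V x)).le_of_opNorm_le hx (u x)
      exact_mod_cast this)
  obtain ⟨D, hD0, hD⟩ := exists_sum_norm_fourier_sq_le (memLp_two_sqrtCLM hV hint)
    (fun x => inner_sqrtCLM_symm (hV x).1) M hM
  obtain ⟨A, hA⟩ := exists_invSqrtLaplacian hd M hD0 (norm_fourier_sq_le_of_orthonormal_bound M hD)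
  exact ⟨_, M, A, hM, hA, rfl⟩

theorem MatrixCLR.IsBirmanSchwinger.isCompactOperator (hd : 3 ≤ d)
    {V : Space d → Matrix (Fin N) (Fin N) ℂ} (hV : ∀ x, (V x).PosSemidef)
    (hint : ∀ i j, MemLp (fun x => V x i j) 1 volume) {K : L2 d N →L[ℂ] L2 d N}
    (hK : IsBirmanSchwinger V K) : IsCompactOperator K := by
  obtain ⟨M, A, hM, hA, rfl⟩ := hK
  obtain ⟨D, -, hD⟩ := exists_sum_norm_fourier_sq_le (memLp_two_sqrtCLM hV hint)
    (fun x => inner_sqrtCLM_symm (hV x).1) M hM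
  exact (isCompactOperator_invSqrtLaplacian hd M A hD hA).clm_comp (ContinuousLinearMap.adjoint A)

theorem MatrixCLR.IsBirmanSchwinger.isSymmetric {V : Space d → Matrix (Fin N) (Fin N) ℂ}
    {K : L2 d N →L[ℂ] L2 d N} (hK : IsBirmanSchwinger V K) : K.IsSymmetric := by
  obtain ⟨M, A, -, -, rfl⟩ := hK
  exact (ContinuousLinearMap.isPositive_adjoint_comp_self A).isSymmetric

theorem MatrixCLR.IsInvSqrtLaplacian.smul {g h : L2 d N} (H : IsInvSqrtLaplacian g h) (c : ℂ) :
    IsInvSqrtLaplacian (c • g) (c • h) := by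
  have hF : ∀ u : L2 d N, (𝓕 (c • u) : L2 d N) = c • (𝓕 u : L2 d N) :=
    (Lp.fourierTransformₗᵢ (Space d) (EuclideanSpace ℂ (Fin N))).map_smul c
  unfold IsInvSqrtLaplacian at H ⊢
  rw [hF, hF]
  filter_upwards [H, Lp.coeFn_smul c (𝓕 g : L2 d N), Lp.coeFn_smul c (𝓕 h : L2 d N)] with p h1 h2 h3
  rw [h2, h3, Pi.smul_apply, Pi.smul_apply, h1, smul_comm]

theorem lintegral_trPow_eq_zero_imp (hd : 2 ≤ d) {V : Space d → Matrix (Fin N) (Fin N) ℂ}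
    (hV : ∀ x, (V x).PosSemidef) (hm : ∀ i j, AEStronglyMeasurable (fun x => V x i j) volume)
    (h0 : ∫⁻ x, ENNReal.ofReal (trPow (V x) ((d : ℝ) / 2)) = 0) :
    ∀ᵐ x, sqrtCLM (V x) = 0 := by
  have hp : 1 ≤ (d : ℝ) / 2 := by
    have : (2 : ℝ) ≤ d := by exact_mod_cast hd
    linarith
  have h1 : ∀ x, (‖sqrtCLM (V x)‖ ^ 2) ^ ((d : ℝ) / 2) ≤
      (N : ℝ) ^ ((d : ℝ) / 2 - 1) * trPow (V x) ((d : ℝ) / 2) := by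
    intro x
    have hv := (hV x).eigenvalues_nonneg
    have h2 := norm_sq_le_of_orthonormalBasis (hV x).1.eigenvectorBasis _ _
      (sqrtCLM_eigenvectorBasis (hV x).1)
    simp only [Real.sq_sqrt (hv _)] at h2
    have h3 := Real.rpow_sum_le_const_mul_sum_rpow Finset.univ (hV x).1.eigenvalues hp
    simp only [abs_of_nonneg (hv _), Finset.card_univ, Fintype.card_fin] at h3
    rw [trPow, trace_cfc_eq_sum (hV x).1]
    exact (Real.rpow_le_rpow (sq_nonneg _) h2 (by linarith)).trans h3
  have h2 : ∫⁻ x, ENNReal.ofReal ((‖sqrtCLM (V x)‖ ^ 2) ^ ((d : ℝ) / 2)) = 0 := by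
    refine le_antisymm ?_ zero_le
    calc _ ≤ ∫⁻ x, ENNReal.ofReal ((N : ℝ) ^ ((d : ℝ) / 2 - 1)) *
          ENNReal.ofReal (trPow (V x) ((d : ℝ) / 2)) := by
            refine lintegral_mono fun x => ?_
            rw [← ENNReal.ofReal_mul (by positivity)]
            exact ENNReal.ofReal_le_ofReal (h1 x)
      _ = 0 := by rw [lintegral_const_mul' _ _ ENNReal.ofReal_ne_top, h0, mul_zero]
  rw [lintegral_eq_zero_iff'] at h2
  · filter_upwards [h2] with x hx
    simp only [Pi.zero_apply, ENNReal.ofReal_eq_zero] at hx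
    have h3 := le_antisymm hx (by positivity)
    rw [Real.rpow_eq_zero (sq_nonneg _) (by linarith)] at h3
    simpa using h3
  · exact ENNReal.measurable_ofReal.comp_aemeasurable
      (((aestronglyMeasurable_sqrtCLM hV hm).norm.aemeasurable.pow_const 2).pow_const _)

theorem MatrixCLR.IsBirmanSchwinger.eq_zero (hd : 0 < d) {V : Space d → Matrix (Fin N) (Fin N) ℂ}
    {K : L2 d N →L[ℂ] L2 d N} (hK : IsBirmanSchwinger V K) (h0 : ∀ᵐ x, sqrtCLM (V x) = 0) :
    K = 0 := by
  obtain ⟨M, A, hM, hA, rfl⟩ := hK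
  have hM0 : ∀ u, M u = 0 := by
    intro u
    rw [Lp.eq_zero_iff_ae_eq_zero]
    filter_upwards [hM u, h0] with x h1 h2
    change M u x = sqrtCLM (V x) (u x) at h1
    rw [h1, h2]
    simp
  have hA0 : A = 0 := by
    ext1 u
    let T := Lp.fourierTransformₗᵢ (Space d) (EuclideanSpace ℂ (Fin N))
    have h1 : T (A u) = 0 := by
      rw [Lp.eq_zero_iff_ae_eq_zero]
      have h2 := hA u
      have h3 : (𝓕 (M u) : L2 d N) = 0 := by rw [hM0]; exact T.map_zero
      unfold IsInvSqrtLaplacian at h2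
      rw [h3] at h2
      filter_upwards [h2, ae_ne_zero_space hd,
        Lp.coeFn_zero (EuclideanSpace ℂ (Fin N)) 2 (volume : Measure (Space d))] with p h4 h5 h6
      rw [h6, eq_comm, Pi.zero_apply, smul_eq_zero] at h4
      refine h4.resolve_left ?_
      have := Real.pi_pos
      have := norm_pos_iff.2 h5
      exact_mod_cast (by positivity : 2 * Real.pi * ‖p‖ ≠ 0)
    simpa using h1
  rw [hA0]
  simp

/-- The trace bound for the functions `g_α(s) = e^{-αs} - 1 + αs`. -/
theorem MatrixCLR.IsBirmanSchwinger.sum_transformF_expRemainder_le (hd : 3 ≤ d)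
    {V : Space d → Matrix (Fin N) (Fin N) ℂ} (hV : ∀ x, (V x).PosSemidef)
    (hint : ∀ i j, MemLp (fun x => V x i j) 1 volume) {K : L2 d N →L[ℂ] L2 d N}
    (hK : IsBirmanSchwinger V K)
    (hJ : ∫⁻ x, ENNReal.ofReal (trPow (V x) ((d : ℝ) / 2)) ≠ 0)
    {ι : Type} [Fintype ι] {e : ι → L2 d N} (he : Orthonormal ℂ e) {μ : ι → ℝ} (hμ : ∀ i, 0 < μ i)
    (heig : ∀ i, K (e i) = ((μ i : ℝ) : ℂ) • e i) (α : ℝ) :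
    ∑ i, transformF (expRemainder α) (μ i) ≤
      ENNReal.ofReal ((4 * Real.pi) ^ (-((d : ℝ) / 2))) * semiclassicalConst d (expRemainder α) *
        ∫⁻ x, ENNReal.ofReal (trPow (V x) ((d : ℝ) / 2)) := by
  have hpi := Real.pi_pos
  rcases eq_or_ne α 0 with rfl | hα0
  · simp [transformF, expRemainder]
  rcases eq_or_ne (semiclassicalConst d (expRemainder α)) ∞ with htop | hfin
  · rw [htop, ENNReal.mul_top (by simp only [ne_eq, ENNReal.ofReal_eq_zero, not_le]; positivity),
      ENNReal.top_mul hJ]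
    exact le_top
  obtain ⟨hα, hd3⟩ := pos_of_semiclassicalConst_expRemainder hd hα0 hfin
  obtain ⟨M, A, hM, hA, rfl⟩ := hK
  set c : ℂ := ((Real.sqrt α : ℝ) : ℂ) with hc
  have hcc : c * c = (α : ℂ) := by
    rw [hc, ← Complex.ofReal_mul, Real.mul_self_sqrt hα.le]
  have h1 := ofReal_sum_subLog_le_phaseSubLog (d := d) (N := N)
    (W := fun x => c • sqrtCLM (V x)) (b := fun x => (hV x).1.eigenvectorBasis)
    (v := fun x j => α * (hV x).1.eigenvalues j) (M := c • M) (A := c • A) hd3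
    ((memLp_two_sqrtCLM hV hint).const_smul c)
    (fun x j => mul_nonneg hα.le ((hV x).eigenvalues_nonneg j))
    (fun x j => by
      rw [smul_apply, sqrtCLM_eigenvectorBasis, smul_smul, hc, ← Complex.ofReal_mul,
        Real.sqrt_mul hα.le])
    (fun u => by
      rw [smul_apply]
      filter_upwards [hM u, Lp.coeFn_smul c (M u)] with x h2 h3
      rw [h3, Pi.smul_apply, h2]
      rfl)
    (fun u => (hA u).smul c) e he (fun i => α * μ i) (fun i => (mul_pos hα (hμ i)).le)
    (fun i => by
      have h2 := heig i
      rw [ContinuousLinearMap.comp_apply] at h2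
      rw [map_smulₛₗ, ContinuousLinearMap.comp_apply, smul_apply, smul_apply, map_smul, h2,
        smul_smul, smul_smul, hc, Complex.conj_ofReal, ← hc, hcc, Complex.ofReal_mul])
  have h2 : phaseSubLog (d := d) (fun x j => α * (hV x).1.eigenvalues j) 0 =
      ENNReal.ofReal ((4 * Real.pi) ^ (-((d : ℝ) / 2))) * semiclassicalConst d (expRemainder α) *
        ∫⁻ x, ENNReal.ofReal (trPow (V x) ((d : ℝ) / 2)) := by
    rw [← lintegral_const_mul' _ _ (ENNReal.mul_ne_top ENNReal.ofReal_ne_top hfin)]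
    refine lintegral_congr fun x => ?_
    have hv := (hV x).eigenvalues_nonneg
    rw [trPow, trace_cfc_eq_sum (hV x).1,
      ENNReal.ofReal_sum_of_nonneg fun j _ => Real.rpow_nonneg (hv j) _, Finset.mul_sum]
    exact Finset.sum_congr rfl fun j _ =>
      lintegral_subLog_div_laplaceSymbol (by omega) hα (hv j)
  rw [h2, ENNReal.ofReal_sum_of_nonneg fun i _ => subLog_nonneg (mul_pos hα (hμ i)).le] at h1
  simpa only [transformF_expRemainder hα (hμ _)] using h1

end BirmanSchwinger

section JensenForm

open scoped ENNReal NNReal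

theorem integrable_expRemainder {m : Measure ℝ} [IsFiniteMeasure m] {s : ℝ}
    (he : Integrable (fun α => Real.exp (-(α * s))) m) (hid : Integrable (fun α => α) m) :
    Integrable (fun α => expRemainder α s) m :=
  (he.sub (integrable_const 1)).add (hid.mul_const s)

/-- Tonelli's theorem for functions of the form `∫ g_α dm(α)`. -/
theorem lintegral_expRemainder_mixture {m : Measure ℝ} [IsFiniteMeasure m] {f : ℝ → ℝ}
    (hint : ∀ s, 0 < s → Integrable (fun α => expRemainder α s) m)
    (hf : ∀ s, 0 < s → f s = ∫ α, expRemainder α s ∂m) {w : ℝ → ℝ} (hw : Measurable w)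
    (hw0 : ∀ s, 0 < s → 0 ≤ w s) :
    ∫⁻ s in Ioi (0 : ℝ), ENNReal.ofReal (f s * w s) =
      ∫⁻ α, (∫⁻ s in Ioi (0 : ℝ), ENNReal.ofReal (expRemainder α s * w s)) ∂m := by
  rw [lintegral_lintegral_swap]
  · refine setLIntegral_congr_fun measurableSet_Ioi fun s hs => ?_
    rw [hf s hs, ← integral_mul_const, ofReal_integral_eq_lintegral_ofReal]
    · exact (hint s hs).mul_const _
    · exact Filter.Eventually.of_forall fun α => mul_nonneg (expRemainder_nonneg _ _) (hw0 s hs)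
  · exact (ENNReal.measurable_ofReal.comp
      (measurable_expRemainder.mul (hw.comp measurable_snd))).aemeasurable

theorem measurable_lintegral_expRemainder {w : ℝ → ℝ} (hw : Measurable w) :
    Measurable fun α =>
      ∫⁻ s in Ioi (0 : ℝ), ENNReal.ofReal (expRemainder α s * w s) :=
  Measurable.lintegral_prod_right' (f := fun q : ℝ × ℝ =>
    ENNReal.ofReal (expRemainder q.1 q.2 * w q.2)) (ENNReal.measurable_ofReal.comp
      (measurable_expRemainder.mul (hw.comp measurable_snd)))

theorem tsum_eq_add_tsum_add_two {a : ℕ → ℝ} {s : ℝ} (h : Summable fun j => a j * s ^ j) :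
    ∑' j, a j * s ^ j = a 0 + a 1 * s + ∑' j, a (j + 2) * s ^ (j + 2) := by
  rw [← h.sum_add_tsum_nat_add 2]
  simp [Finset.sum_range_succ]

theorem tsum_add_two_le {a : ℕ → ℝ} (ha : ∀ j, 2 ≤ j → 0 ≤ a j)
    (h : ∀ s : ℝ, 0 ≤ s → Summable fun j => a j * s ^ j) {s : ℝ} (hs : 0 ≤ s) (hs1 : s ≤ 1) :
    ∑' j, a (j + 2) * s ^ (j + 2) ≤ s ^ 2 * ∑' j, a (j + 2) := by
  have h1 : Summable fun j => a (j + 2) := by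
    have := (summable_nat_add_iff 2).2 (h 1 zero_le_one)
    simpa using this
  rw [← tsum_mul_left]
  refine ((summable_nat_add_iff 2).2 (h s hs)).tsum_le_tsum (fun j => ?_) (h1.mul_left _)
  have := pow_le_one₀ (n := j) hs hs1
  rw [pow_add, mul_comm (s ^ 2)]
  refine mul_le_mul_of_nonneg_left ?_ (ha _ (by omega))
  exact mul_le_of_le_one_left (sq_nonneg _) this

/-- If `∫ f(s) s^{-d/2-1} ds` is finite then `f` is a superposition of the functions
`g_α(s) = e^{-αs} - 1 + αs`. -/
theorem exists_expRemainder_mixture {d : ℕ} (hd : 2 ≤ d) {f : ℝ → ℝ} (hf : IsJensenForm f)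
    (hf0 : ∀ s : ℝ, 0 ≤ s → 0 ≤ f s) (hI : semiclassicalConst d f ≠ ∞) :
    ∃ m : Measure ℝ, IsFiniteMeasure m ∧
      (∀ s, 0 < s → Integrable (fun α => expRemainder α s) m) ∧
      ∀ s, 0 < s → f s = ∫ α, expRemainder α s ∂m := by
  obtain ⟨a, m, ha, h⟩ := hf
  have hsum : ∀ s : ℝ, 0 ≤ s → Summable fun j => a j * s ^ j := fun s hs => (h s hs).1
  have hexp : ∀ s : ℝ, 0 ≤ s → Integrable (fun α => Real.exp (-(α * s))) m :=
    fun s hs => (h s hs).2.1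
  have hm : IsFiniteMeasure m := by
    have := hexp 0 le_rfl
    simp only [mul_zero, neg_zero, Real.exp_zero] at this
    exact (integrable_const_iff_isFiniteMeasure one_ne_zero).1 this
  have hd2 : (1 : ℝ) ≤ (d : ℝ) / 2 := by
    have : (2 : ℝ) ≤ d := by exact_mod_cast hd
    linarith
  -- a sequence along which `f(s) / s` tends to zero
  have hseq : ∀ n : ℕ, ∃ s : ℝ, 0 < s ∧ s < 1 / ((n : ℝ) + 1) ∧ f s < 1 / ((n : ℝ) + 1) * s := by
    intro n
    obtain ⟨s, h1, h2, h3⟩ := exists_lt_mul_rpow hI (c := 1 / ((n : ℝ) + 1)) (r := 1)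
      (δ := 1 / ((n : ℝ) + 1)) Nat.one_div_pos_of_nat Nat.one_div_pos_of_nat hd2
    exact ⟨s, h1, h2, by rwa [Real.rpow_one] at h3⟩
  choose s hs hslt hfs using hseq
  have hs1 : ∀ n, s n ≤ 1 := fun n => (hslt n).le.trans (by
    rw [div_le_one (by positivity)]; linarith [n.cast_nonneg (α := ℝ)])
  have hlim0 := tendsto_one_div_add_atTop_nhds_zero_nat (𝕜 := ℝ)
  have hst : Filter.Tendsto s Filter.atTop (nhds 0) :=
    squeeze_zero (fun n => (hs n).le) (fun n => (hslt n).le) hlim0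
  have hft : Filter.Tendsto (fun n => f (s n) / s n) Filter.atTop (nhds 0) := by
    refine squeeze_zero (fun n => div_nonneg (hf0 _ (hs n).le) (hs n).le) (fun n => ?_) hlim0
    rw [div_le_iff₀ (hs n)]
    exact (hfs n).le
  set T : ℝ → ℝ := fun s => ∑' j, a (j + 2) * s ^ (j + 2) with hT
  have hT0 : ∀ s, 0 ≤ s → 0 ≤ T s := fun s hs =>
    tsum_nonneg fun j => mul_nonneg (ha _ (by omega)) (by positivity)
  have hTt : Filter.Tendsto (fun n => T (s n) / s n) Filter.atTop (nhds 0) := by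
    have h1 := hst.mul_const (∑' j, a (j + 2))
    rw [zero_mul] at h1
    refine squeeze_zero (fun n => div_nonneg (hT0 _ (hs n).le) (hs n).le) (fun n => ?_) h1
    rw [div_le_iff₀ (hs n)]
    refine (tsum_add_two_le ha hsum (hs n).le (hs1 n)).trans (le_of_eq (by ring))
  have hform : ∀ r : ℝ, 0 ≤ r → f r = a 0 + a 1 * r + T r + ∫ α, Real.exp (-(α * r)) ∂m := by
    intro r hr
    rw [(h r hr).2.2, tsum_eq_add_tsum_add_two (hsum r hr)]
  -- the constant term vanishes
  have hmul : ∀ g : ℝ → ℝ, Filter.Tendsto (fun n => g (s n) / s n) Filter.atTop (nhds 0) →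
      Filter.Tendsto (fun n => g (s n)) Filter.atTop (nhds 0) := by
    intro g hg
    have := hg.mul hst
    rw [mul_zero] at this
    exact this.congr fun n => div_mul_cancel₀ _ (hs n).ne'
  have hexpt : Filter.Tendsto (fun n => ∫ α, Real.exp (-(α * s n)) ∂m) Filter.atTop
      (nhds (∫ _, (1 : ℝ) ∂m)) := by
    refine tendsto_integral_of_dominated_convergence (fun α => 1 + Real.exp (-(α * 1)))
      (fun n => (hexp _ (hs n).le).1) ((integrable_const 1).add (hexp 1 zero_le_one))
      (fun n => Filter.Eventually.of_forall fun α => ?_) (Filter.Eventually.of_forall fun α => ?_)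
    · rw [Real.norm_of_nonneg (Real.exp_pos _).le]
      rcases le_total 0 α with hα | hα
      · have : Real.exp (-(α * s n)) ≤ 1 := Real.exp_le_one_iff.2 (by
          have := mul_nonneg hα (hs n).le; linarith)
        linarith [Real.exp_pos (-(α * 1))]
      · have : Real.exp (-(α * s n)) ≤ Real.exp (-(α * 1)) := Real.exp_le_exp.2 (by
          nlinarith [hs1 n])
        linarith
    · have h1 : Filter.Tendsto (fun n => Real.exp (-(α * s n))) Filter.atTop
          (nhds (Real.exp (-(α * 0)))) :=
        (Real.continuous_exp.tendsto _).comp (hst.const_mul α).neg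
      simpa using h1
  have hc0 : a 0 + ∫ _, (1 : ℝ) ∂m = 0 := by
    have h1 : Filter.Tendsto (fun n => f (s n)) Filter.atTop
        (nhds (a 0 + a 1 * 0 + 0 + ∫ _, (1 : ℝ) ∂m)) := by
      simp only [hform _ (hs _).le]
      exact ((tendsto_const_nhds.add (hst.const_mul _)).add (hmul T hTt)).add hexpt
    have := tendsto_nhds_unique h1 (hmul f hft)
    simpa using this
  -- the difference quotients of the exponentials
  set q : ℝ → ℝ → ℝ := fun r α => (1 - Real.exp (-(α * r))) / r with hq
  have hqint : ∀ r, 0 < r → Integrable (q r) m := fun r hr =>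
    ((integrable_const 1).sub (hexp r hr.le)).div_const r
  have hqval : ∀ r, 0 < r → ∫ α, q r α ∂m = a 1 + T r / r - f r / r := by
    intro r hr
    simp only [hq]
    rw [integral_div, integral_sub (integrable_const 1) (hexp r hr.le), hform r hr.le]
    have : a 0 = - ∫ _, (1 : ℝ) ∂m := by linarith
    rw [this]
    generalize ∫ α, Real.exp (-(α * r)) ∂m = y
    field_simp
    ring
  have hqt : Filter.Tendsto (fun n => ∫ α, q (s n) α ∂m) Filter.atTop (nhds (a 1)) := by
    simp only [hqval _ (hs _)]
    simpa using (hTt.const_add (a 1)).sub hft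
  have hqmono : ∀ r, 0 < r → r ≤ 1 → ∀ α, q 1 α ≤ q r α := by
    intro r hr hr1 α
    simp only [hq]
    have hconv := convexOn_exp.2 (mem_univ (-(α * 1))) (mem_univ 0) hr.le
      (by linarith : 0 ≤ 1 - r) (by ring)
    simp only [smul_eq_mul, mul_zero, add_zero, Real.exp_zero, mul_one] at hconv
    rw [mul_one, div_one, le_div_iff₀ hr]
    have e : r * -α = -(α * r) := by ring
    rw [e] at hconv
    linarith
  have hqlim : ∀ α, Filter.Tendsto (fun n => q (s n) α) Filter.atTop (nhds α) := by
    intro α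
    have h1 : HasDerivAt (fun r : ℝ => -Real.exp (-(α * r))) α 0 := by
      have h2 : HasDerivAt (fun r : ℝ => -(α * r)) (-(α * 1)) 0 :=
        ((hasDerivAt_id (0 : ℝ)).const_mul α).neg
      refine h2.exp.neg.congr_deriv ?_
      simp
    have h3 := hasDerivAt_iff_tendsto_slope_zero.1 h1
    have h4 : Filter.Tendsto s Filter.atTop (nhdsWithin 0 {0}ᶜ) :=
      tendsto_nhdsWithin_iff.2 ⟨hst, Filter.Eventually.of_forall fun n => (hs n).ne'⟩
    refine (h3.comp h4).congr fun n => ?_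
    simp only [hq, Function.comp_apply, zero_add, mul_zero, neg_zero, Real.exp_zero, smul_eq_mul]
    field_simp
    ring
  -- by the Fatou lemma, the first moment of m is finite
  have hfatou : ∫⁻ α, ENNReal.ofReal (α - q 1 α) ∂m ≤
      ENNReal.ofReal (a 1 - ∫ α, q 1 α ∂m) := by
    have h1 : Filter.Tendsto (fun n => ENNReal.ofReal (∫ α, q (s n) α ∂m - ∫ α, q 1 α ∂m))
        Filter.atTop (nhds (ENNReal.ofReal (a 1 - ∫ α, q 1 α ∂m))) :=
      ENNReal.tendsto_ofReal (hqt.sub_const _)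
    have h2 : ∀ n, ENNReal.ofReal (∫ α, q (s n) α ∂m - ∫ α, q 1 α ∂m) =
        ∫⁻ α, ENNReal.ofReal (q (s n) α - q 1 α) ∂m := by
      intro n
      rw [← integral_sub (hqint _ (hs n)) (hqint 1 one_pos),
        ofReal_integral_eq_lintegral_ofReal]
      · exact (hqint _ (hs n)).sub (hqint 1 one_pos)
      · exact Filter.Eventually.of_forall fun α => sub_nonneg.2 (hqmono _ (hs n) (hs1 n) α)
    rw [← h1.liminf_eq]
    simp only [h2]
    refine le_trans (le_of_eq (lintegral_congr fun α => ?_)) (lintegral_liminf_le fun n => ?_)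
    · exact ((ENNReal.tendsto_ofReal ((hqlim α).sub_const _)).liminf_eq).symm
    · simp only [hq]
      fun_prop
  have hq1 : ∀ α, 0 ≤ α - q 1 α := fun α =>
    sub_nonneg.2 (ge_of_tendsto' (hqlim α) fun n => hqmono _ (hs n) (hs1 n) α)
  have hdint : Integrable (fun α => α - q 1 α) m := by
    refine ⟨Measurable.aestronglyMeasurable (by simp only [hq]; fun_prop), ?_⟩
    rw [hasFiniteIntegral_iff_ofReal (Filter.Eventually.of_forall hq1)]
    exact hfatou.trans_lt ENNReal.ofReal_lt_top
  have hid : Integrable (fun α : ℝ => α) m := by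
    refine (hdint.add (hqint 1 one_pos)).congr (Filter.Eventually.of_forall fun α => ?_)
    simp
  have hle : ∫ α, α ∂m ≤ a 1 := by
    rw [← ofReal_integral_eq_lintegral_ofReal hdint (Filter.Eventually.of_forall hq1)] at hfatou
    have h1 : ∫ α, q 1 α ∂m ≤ a 1 :=
      ge_of_tendsto' hqt fun n =>
        integral_mono (hqint 1 one_pos) (hqint _ (hs n)) (hqmono _ (hs n) (hs1 n))
    rw [ENNReal.ofReal_le_ofReal_iff (by linarith), integral_sub hid (hqint 1 one_pos)] at hfatou
    linarith
  have hgint : ∀ r, 0 < r → Integrable (fun α => expRemainder α r) m := fun r hr =>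
    integrable_expRemainder (hexp r hr.le) hid
  have hform2 : ∀ r, 0 < r → f r = (a 1 - ∫ α, α ∂m) * r + T r + ∫ α, expRemainder α r ∂m := by
    intro r hr
    have h1 : ∫ α, expRemainder α r ∂m =
        (∫ α, Real.exp (-(α * r)) ∂m - ∫ _, (1 : ℝ) ∂m) + (∫ α, α ∂m) * r := by
      unfold expRemainder
      have h2 : Integrable (fun α => Real.exp (-(α * r)) - 1) m :=
        (hexp r hr.le).sub (integrable_const 1)
      rw [integral_add h2 (hid.mul_const r), integral_sub (hexp r hr.le) (integrable_const 1),
        integral_mul_const]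
    rw [h1, hform r hr.le]
    have : a 0 = - ∫ _, (1 : ℝ) ∂m := by linarith
    rw [this]
    ring
  have hg0 : ∀ r, 0 ≤ ∫ α, expRemainder α r ∂m := fun r =>
    integral_nonneg fun α => expRemainder_nonneg α r
  have hb : a 1 - ∫ α, α ∂m = 0 :=
    eq_zero_of_rpow_le hI (r := 1) (by linarith) fun r hr => by
      rw [Real.rpow_one, hform2 r hr]
      linarith [hT0 r hr.le, hg0 r]
  have haj : ∀ j, a (j + 2) = 0 := fun j =>
    eq_zero_of_rpow_le hI (r := ((j + 2 : ℕ) : ℝ)) (ha _ (by omega)) fun r hr => by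
      rw [Real.rpow_natCast, hform2 r hr, hb, zero_mul, zero_add]
      have h1 : a (j + 2) * r ^ (j + 2) ≤ T r :=
        ((summable_nat_add_iff 2).2 (hsum r hr.le)).le_tsum j fun i _ =>
          mul_nonneg (ha _ (by omega)) (by positivity)
      linarith [hg0 r]
  refine ⟨m, hm, hgint, fun r hr => ?_⟩
  rw [hform2 r hr, hb]
  simp [hT, haj]

end JensenForm

theorem corollary1 (d N : ℕ) (hd : 3 ≤ d)
    (f : ℝ → ℝ) (hf : IsJensenForm f) (hf_nonneg : ∀ s : ℝ, 0 ≤ s → 0 ≤ f s)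
    (V : Space d → Matrix (Fin N) (Fin N) ℂ)
    (hV_nonneg : ∀ x, (V x).PosSemidef)
    (hV_integrable : ∀ i j, MemLp (fun x => V x i j) 1 volume)
    (hV_bounded : ∀ i j, MemLp (fun x => V x i j) ⊤ volume) :
    (∃ K : L2 d N →L[ℂ] L2 d N, IsBirmanSchwinger V K) ∧
    ∀ K : L2 d N →L[ℂ] L2 d N, IsBirmanSchwinger V K →
      IsCompactOperator K ∧
      traceOfFun (transformF f) K ≤
        ENNReal.ofReal ((4 * Real.pi) ^ (-((d : ℝ) / 2))) *
          (∫⁻ s in Ioi (0 : ℝ), ENNReal.ofReal (f s * s ^ (-((d : ℝ) / 2) - 1))) *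
          ∫⁻ x, ENNReal.ofReal (trPow (V x) ((d : ℝ) / 2)) := by
  refine ⟨exists_isBirmanSchwinger hd hV_nonneg hV_integrable hV_bounded, fun K hK => ?_⟩
  have hc := hK.isCompactOperator hd hV_nonneg hV_integrable
  refine ⟨hc, traceOfFun_le_of_eigenvectors _ K hc hK.isSymmetric _ ?_⟩
  intro ι _ e μ he hμ heig
  have hpi := Real.pi_pos
  rcases eq_or_ne (∫⁻ x, ENNReal.ofReal (trPow (V x) ((d : ℝ) / 2))) 0 with hJ | hJ
  · have hK0 := hK.eq_zero (by omega) (lintegral_trPow_eq_zero_imp (by omega) hV_nonneg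
      (fun i j => (hV_integrable i j).1) hJ)
    have : IsEmpty ι := ⟨fun i => by
      have h1 := heig i
      rw [hK0, zero_apply, eq_comm, smul_eq_zero, Complex.ofReal_eq_zero] at h1
      exact h1.elim (hμ i).ne' (he.ne_zero i)⟩
    simp
  change _ ≤ _ * semiclassicalConst d f * _
  rcases eq_or_ne (semiclassicalConst d f) ⊤ with hI | hI
  · rw [hI, ENNReal.mul_top (by simp only [ne_eq, ENNReal.ofReal_eq_zero, not_le]; positivity),
      ENNReal.top_mul hJ]
    exact le_top
  obtain ⟨m, hm, hint, hrep⟩ := exists_expRemainder_mixture (by omega) hf hf_nonneg hI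
  have hw1 : ∀ lam : ℝ, Measurable fun s : ℝ => Real.exp (-(s / lam)) * s⁻¹ := fun lam => by
    fun_prop
  have hw2 : Measurable fun s : ℝ => s ^ (-((d : ℝ) / 2) - 1) := by fun_prop
  have hF : ∀ i, transformF f (μ i) = ∫⁻ α, transformF (expRemainder α) (μ i) ∂m := by
    intro i
    simp only [transformF, mul_assoc]
    exact lintegral_expRemainder_mixture hint hrep (hw1 _) fun s hs => by positivity
  have hIf : semiclassicalConst d f = ∫⁻ α, semiclassicalConst d (expRemainder α) ∂m :=
    lintegral_expRemainder_mixture hint hrep hw2 fun s hs => by positivity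
  have hFm : ∀ i, Measurable fun α => transformF (expRemainder α) (μ i) := by
    intro i
    simp only [transformF, mul_assoc]
    exact measurable_lintegral_expRemainder (hw1 _)
  have hIm : Measurable fun α => semiclassicalConst d (expRemainder α) :=
    measurable_lintegral_expRemainder hw2
  simp only [hF]
  rw [← lintegral_finsetSum _ fun i _ => hFm i, hIf, ← lintegral_const_mul _ hIm,
    ← lintegral_mul_const _ (hIm.const_mul _)]
  exact lintegral_mono fun α =>
    hK.sum_transformF_expRemainder_le hd hV_nonneg hV_integrable hJ he hμ heig α
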